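/- **Theorem.** Consider the master system $$\dot x = Ax+\varphi_0(y)+b\,\varphi(y)^T\theta,\qquad y=c^Tx,\qquad y_r=y+\xi,\qquad t\ge 0,$$ with $x(t)\in\mathbb R^n$, $\theta\in\mathbb R^m$ a constant vector, $A\in\mathbb R^{n\times n}$, $b,c\in\mathbb R^n$, and $\xi$ a bounded measurable function of time. Assume that $\varphi_0:\mathbb R\to\mathbb R^n$ and $\varphi:\mathbb R\to\mathbb R^m$ are Borel measurable and bounded on bounded sets, and that for every parameter vector and every initial state the state of the master system is a bounded function of $t\ge0$. Let $k\in\mathbb R^n$ be such that $F=A-kc^T$ is Hurwitz (all eigenvalues have negative real part), and put $H(p)=c^T(pI-F)^{-1}b$. For a scalar signal $u$, $H(p)[u]$ denotes the output $c^T\zeta$ of the filter $\dot\zeta=F\zeta+bu$ with an arbitrary initial value; on vector signals $H(p)$ acts componentwise. Differential equations are understood in the sense of Carathéodory, i.e. in integrated form, and $|\cdot|$ is the Euclidean norm. Given a trajectory $x$ of the master system on $[0,\infty)$, let $\bar\varphi(t)=\varphi(y_r(t))$, $\bar\omega=H(p)[\bar\varphi]$, and consider the adaptive observer $$\dot{\hat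 x}=A\hat x+\varphi_0(y_r)+b\,\varphi(y_r)^T\hat\theta+k(y_r-\hat y),\qquad \hat y=c^T\hat x,$$ $$\bar e=y_r-\hat y+H(p)[\bar\varphi^T\hat\theta]-\bar\omega^T\hat\theta,\qquad \dot{\hat\theta}=\gamma\,\bar\omega\,\bar e-\alpha(\hat\theta)\hat\theta,$$ $$\alpha(\hat\theta)=\begin{cases}0,&|\hat\theta|<\theta^*,\\ |\hat\theta|/\theta^*-1,&\theta^*\le|\hat\theta|\le2\theta^*,\\ 1,&|\hat\theta|>2\theta^*,\end{cases}$$ where $\gamma>0$ and $\theta^*>0$ are arbitrary. Let $\tilde\theta=\theta-\hat\theta$. Then for all initial conditions (of the observer, the estimate and the filters) the closed loop has a solution on $[0,\infty)$, and every solution on $[0,\infty)$ has the following properties. (i) All signals $x,y,y_r,\hat x,\hat y,\hat\theta,\tilde\theta,\bar\omega,\bar e$, the filter states, and the filter output $H(p)[\bar\varphi^T\hat\theta]$ are bounded on $[0,\infty)$. The system $$\dot\Xi_e=F\Xi_e+\varphi_0(y)-\varphi_0(y_r)+b\big(\varphi(y)-\varphi(y_r)\big)^T\theta-k\xi,\qquad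 \xi_e=c^T\Xi_e,$$ has a solution on $[0,\infty)$ for every initial value $\Xi_e(0)$, and for each of its solutions $\Xi_e$ and $\xi_e$ are bounded and $\tilde\theta(t)$ converges as $t\to\infty$ (its distance to the set tends to $0$) to the residual set $$D=\Big\{v\in\mathbb R^m:\ |v|^2\le\max\big[(|\theta|+2\theta^*)^2,\ \gamma\|\xi+\xi_e\|_\infty^2+|\theta|^2\big]\Big\},$$ where $\|\cdot\|_\infty$ is the $L^\infty$ norm on $[0,\infty)$. (ii) If $\xi\equiv0$ and $\theta^*>|\theta|$, then in addition $\lim_{t\to\infty}(y(t)-\hat y(t))=0$. (iii) If, additionally to the hypotheses of (ii), $\varphi$ is continuous, the function $f(t)=\varphi(y(t))$ is persistently exciting (measurable and bounded on $[0,\infty)$, with $\int_t^{t+T}f(s)f(s)^T\,ds\ge\alpha_0 I$ for all $t\ge0$ and some $\alpha_0,T>0$), and $H$ is minimum phase ($H(s)\ne0$ for all $s\in\mathbb C$ with $\operatorname{Re}s\ge0$), then $\lim_{t\to\infty}|\theta-\hat\theta(t)|=0$. -/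

import Mathlib

open MeasureTheory Filter Topology
open scoped Matrix

noncomputable section

namespace AdaptiveSync

/-- `z` is a solution on `[0, ∞)` of `ż = v` in the sense of Carathéodory: `v` is integrable on
every `[0, t]` and `z t = z 0 + ∫₀ᵗ v` (so `z` is absolutely continuous on every `[0, t]`). -/
def HasVelocity {E : Type*} [NormedAddCommGroup E] [NormedSpace ℝ E] (z v : ℝ → E) : Prop :=
  ∀ t, 0 ≤ t → IntervalIntegrable v volume 0 t ∧ z t = z 0 + ∫ s in (0 : ℝ)..t, v s

/-- Boundedness of a signal on `[0, ∞)`. -/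
def BoundedSignal {E : Type*} [Norm E] (z : ℝ → E) : Prop :=
  ∃ C : ℝ, ∀ t, 0 ≤ t → ‖z t‖ ≤ C

/-- A function of the output that is bounded for bounded values of its argument. -/
def LocallyBounded {E : Type*} [Norm E] (f : ℝ → E) : Prop :=
  ∀ R : ℝ, ∃ C : ℝ, ∀ y : ℝ, |y| ≤ R → ‖f y‖ ≤ C

/-- The known data of the master system `ẋ = A x + φ₀(y) + b φ(y)ᵀ θ`, `y = cᵀ x`. -/
structure Plant (n m : ℕ) where
  A : Matrix (Fin n) (Fin n) ℝ
  b : Fin n → ℝ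
  c : Fin n → ℝ
  φ₀ : ℝ → Fin n → ℝ
  φ : ℝ → EuclideanSpace ℝ (Fin m)

/-- A real square matrix is Hurwitz if all its complex eigenvalues have negative real part. -/
def IsHurwitz {n : ℕ} (F : Matrix (Fin n) (Fin n) ℝ) : Prop :=
  ∀ s ∈ spectrum ℂ (F.map Complex.ofReal), s.re < 0

/-- The transfer function `H(s) = cᵀ (s I - F)⁻¹ b`, for `s` outside the spectrum of `F`. -/
def transferFunction {n : ℕ} (F : Matrix (Fin n) (Fin n) ℝ) (b c : Fin n → ℝ) (s : ℂ) : ℂ :=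
  (fun i => (c i : ℂ)) ⬝ᵥ
    ((s • (1 : Matrix (Fin n) (Fin n) ℂ) - F.map Complex.ofReal)⁻¹ *ᵥ fun i => (b i : ℂ))

/-- Minimum phase for a Hurwitz `F` (so that `H` has no pole with `0 ≤ Re s`): all zeros of the
transfer function have negative real part. -/
def IsMinimumPhase {n : ℕ} (F : Matrix (Fin n) (Fin n) ℝ) (b c : Fin n → ℝ) : Prop :=
  ∀ s : ℂ, 0 ≤ s.re → transferFunction F b c s ≠ 0

/-- Persistent excitation on `[0, ∞)`: measurable, bounded, and
`∫ₜ^{t+T} f(s) f(s)ᵀ ds ≥ α I` for all `t ≥ 0`, with some `α, T > 0`. -/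
def PersistentlyExciting {m : ℕ} (f : ℝ → EuclideanSpace ℝ (Fin m)) : Prop :=
  (Measurable fun t : Set.Ici (0 : ℝ) => f t) ∧ BoundedSignal f ∧
    ∃ α T : ℝ, 0 < α ∧ 0 < T ∧ ∀ t, 0 ≤ t →
      ((Matrix.of fun i j : Fin m => ∫ s in t..(t + T), f s i * f s j)
        - α • (1 : Matrix (Fin m) (Fin m) ℝ)).PosSemidef

/-- `ζ` is the state, from an arbitrary initial value, of the filter with transfer function
`H(p) = cᵀ (p I - F)⁻¹ b` driven by `u`; the filter output `H(p)[u]` is then `cᵀ ζ`. -/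
def IsFilterState {n : ℕ} (F : Matrix (Fin n) (Fin n) ℝ) (b : Fin n → ℝ) (u : ℝ → ℝ)
    (ζ : ℝ → Fin n → ℝ) : Prop :=
  HasVelocity ζ fun t => F *ᵥ ζ t + u t • b

/-- The switching function of the dead-zone `σ`-modification with threshold `θs`. -/
def switching {m : ℕ} (θs : ℝ) (θh : EuclideanSpace ℝ (Fin m)) : ℝ :=
  if ‖θh‖ < θs then 0 else if ‖θh‖ ≤ 2 * θs then ‖θh‖ / θs - 1 else 1

/-- The `L^∞` norm on `[0, ∞)`. -/
def supNorm (f : ℝ → ℝ) : ℝ :=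
  (eLpNorm f ⊤ (volume.restrict (Set.Ici (0 : ℝ)))).toReal

/-- The residual set of the parameter error, for the total disturbance `d = ξ + ξₑ`. -/
def residualSet {m : ℕ} (γ θs : ℝ) (θ : EuclideanSpace ℝ (Fin m)) (d : ℝ → ℝ) :
    Set (EuclideanSpace ℝ (Fin m)) :=
  {v | ‖v‖ ^ 2 ≤ max ((‖θ‖ + 2 * θs) ^ 2) (γ * supNorm d ^ 2 + ‖θ‖ ^ 2)}

namespace Plant

variable {n m : ℕ}

/-- `x` is a trajectory on `[0, ∞)` of the master system with parameter vector `θ`. -/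
def IsTrajectory (P : Plant n m) (θ : EuclideanSpace ℝ (Fin m)) (x : ℝ → Fin n → ℝ) : Prop :=
  HasVelocity x fun t =>
    P.A *ᵥ x t + P.φ₀ (P.c ⬝ᵥ x t) + (inner ℝ (P.φ (P.c ⬝ᵥ x t)) θ) • P.b

/-- For every parameter vector and every initial state, the state of the master system is a
bounded function of time. -/
def BoundedTrajectories (P : Plant n m) : Prop :=
  ∀ (θ : EuclideanSpace ℝ (Fin m)) (x : ℝ → Fin n → ℝ), P.IsTrajectory θ x → BoundedSignal x

/-- `F = A - k cᵀ`. -/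
def errorMatrix (P : Plant n m) (k : Fin n → ℝ) : Matrix (Fin n) (Fin n) ℝ :=
  P.A - Matrix.vecMulVec k P.c

/-- The output signal `cᵀ z`. -/
def output (P : Plant n m) (z : ℝ → Fin n → ℝ) (t : ℝ) : ℝ :=
  P.c ⬝ᵥ z t

/-- The received signal `y_r = y + ξ`. -/
def received (P : Plant n m) (ξ : ℝ → ℝ) (x : ℝ → Fin n → ℝ) (t : ℝ) : ℝ :=
  P.output x t + ξ t

/-- The filtered regressor `ω̄ = H(p)[φ̄]`, where `Ω i` is the state of the filter driven by the
`i`-th component of `φ̄`. -/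
def filteredRegressor (P : Plant n m) (Ω : Fin m → ℝ → Fin n → ℝ) (t : ℝ) :
    EuclideanSpace ℝ (Fin m) :=
  WithLp.toLp 2 fun i => P.output (Ω i) t

/-- The augmented error `ē = y_r - ŷ + H(p)[φ̄ᵀ θ̂] - ω̄ᵀ θ̂`, where `ζ` is the state of the filter
driven by `φ̄ᵀ θ̂`. -/
def augmentedError (P : Plant n m) (ξ : ℝ → ℝ) (x xh : ℝ → Fin n → ℝ)
    (θh : ℝ → EuclideanSpace ℝ (Fin m)) (ζ : ℝ → Fin n → ℝ) (Ω : Fin m → ℝ → Fin n → ℝ)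
    (t : ℝ) : ℝ :=
  P.received ξ x t - P.output xh t + P.output ζ t - inner ℝ (P.filteredRegressor Ω t) (θh t)

/-- The closed loop driven by the master trajectory `x` and the noise `ξ`: observer state `xh`,
parameter estimate `θh`, and the states `ζ`, `Ω` of the filters in the augmentation scheme. -/
structure IsClosedLoop (P : Plant n m) (k : Fin n → ℝ) (γ θs : ℝ) (ξ : ℝ → ℝ)
    (x xh : ℝ → Fin n → ℝ) (θh : ℝ → EuclideanSpace ℝ (Fin m)) (ζ : ℝ → Fin n → ℝ)
    (Ω : Fin m → ℝ → Fin n → ℝ) : Prop where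
  observer : HasVelocity xh fun t =>
    P.A *ᵥ xh t + P.φ₀ (P.received ξ x t) + (inner ℝ (P.φ (P.received ξ x t)) (θh t)) • P.b
      + (P.received ξ x t - P.output xh t) • k
  filter : IsFilterState (P.errorMatrix k) P.b
    (fun t => inner ℝ (P.φ (P.received ξ x t)) (θh t)) ζ
  regressor : ∀ i, IsFilterState (P.errorMatrix k) P.b (fun t => P.φ (P.received ξ x t) i) (Ω i)
  adaptation : HasVelocity θh fun t =>
    (γ * P.augmentedError ξ x xh θh ζ Ω t) • P.filteredRegressor Ω t
      - switching θs (θh t) • θh t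

/-- `Ξ̇ₑ = F Ξₑ + φ₀(y) - φ₀(y_r) + b (φ(y) - φ(y_r))ᵀ θ - k ξ`. -/
def IsNoiseResponse (P : Plant n m) (k : Fin n → ℝ) (θ : EuclideanSpace ℝ (Fin m)) (ξ : ℝ → ℝ)
    (x : ℝ → Fin n → ℝ) (Ξ : ℝ → Fin n → ℝ) : Prop :=
  HasVelocity Ξ fun t =>
    P.errorMatrix k *ᵥ Ξ t + (P.φ₀ (P.output x t) - P.φ₀ (P.received ξ x t))
      + (inner ℝ (P.φ (P.output x t) - P.φ (P.received ξ x t)) θ) • P.b - ξ t • k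

end Plant

end AdaptiveSync

end

open AdaptiveSync

/-!
Everything rests on coordinates in which the closed loop is a cascade. The difference
`ψ = x̂ - ζ` of the observer state and the state of the filter of `φ̄ᵀ θ̂` obeys
`ψ̇ = F ψ + φ₀(y_r) + k y_r`, so neither `ψ` nor the regressor filters see the estimate, and
`ē = ω̄ᵀ(θ - θ̂) + δ` with `δ = y_r - cᵀ ψ - ω̄ᵀ θ`. Moreover `ε = x - ψ - Ξₑ - ∑ᵢ θᵢ Ωᵢ` solves
the unforced equation `ε̇ = F ε`, so that `δ = ξ + ξₑ + cᵀ ε` with `ε` decaying exponentially.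

Along the adaptation law `|θ - θ̂|²` decreases, at a rate bounded away from zero, whenever it
exceeds the level of the residual set by a fixed amount. Without noise, integrating its rate of
decrease and applying Barbalat's lemma gives `ω̄ᵀ(θ - θ̂) → 0` and `α(θ̂) θ̂ → 0`, hence a
vanishing velocity of `θ̂`. For a slow `θ̂`, `H(p)[φ̄ᵀ θ̂]` and `ω̄ᵀ θ̂` merge, which yields the
regulation of the output, and `∑ᵢ (θ - θ̂)ᵢ Ωᵢ` is asymptotically a filter state driven by
`φ̄ᵀ(θ - θ̂)`, with vanishing output. A minimum phase filter with vanishing output and uniformly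
continuous input has a vanishing input, so `φ(y)ᵀ(θ - θ̂) → 0`, and persistent excitation turns
this into `θ̂ → θ`.
-/

namespace AdaptiveSync

/-! ### Calculus of Carathéodory solutions -/

namespace HasVelocity

variable {E F G : Type*} [NormedAddCommGroup E] [NormedSpace ℝ E] [NormedAddCommGroup F]
  [NormedSpace ℝ F] [NormedAddCommGroup G] [NormedSpace ℝ G] {z v w u : ℝ → E}

theorem congr {z' v' : ℝ → E} (h : HasVelocity z v) (hz : ∀ t, 0 ≤ t → z t = z' t)
    (hv : ∀ t, 0 ≤ t → v t = v' t) : HasVelocity z' v' := by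
  intro t ht
  have hE : Set.EqOn v v' (Set.uIoc 0 t) := fun s hs => by
    rw [Set.uIoc_of_le ht] at hs
    exact hv s hs.1.le
  refine ⟨(h t ht).1.congr hE, ?_⟩
  rw [← hz t ht, ← hz 0 le_rfl, (h t ht).2,
    intervalIntegral.integral_congr_ae (Eventually.of_forall hE)]

theorem congr_velocity {v' : ℝ → E} (h : HasVelocity z v) (hv : ∀ t, 0 ≤ t → v t = v' t) :
    HasVelocity z v' :=
  h.congr (fun _ _ => rfl) hv

theorem intervalIntegrable (h : HasVelocity z v) {s t : ℝ} (hs : 0 ≤ s) (ht : 0 ≤ t) :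
    IntervalIntegrable v volume s t :=
  (h s hs).1.symm.trans (h t ht).1

theorem sub_eq_integral (h : HasVelocity z v) {s t : ℝ} (hs : 0 ≤ s) (ht : 0 ≤ t) :
    z t - z s = ∫ r in s..t, v r := by
  rw [(h t ht).2, (h s hs).2, add_sub_add_left_eq_sub,
    intervalIntegral.integral_interval_sub_left (h t ht).1 (h s hs).1]

theorem add (h : HasVelocity z v) (h' : HasVelocity w u) :
    HasVelocity (fun t => z t + w t) (fun t => v t + u t) := fun t ht =>
  ⟨(h t ht).1.add (h' t ht).1, by
    beta_reduce
    rw [intervalIntegral.integral_add (h t ht).1 (h' t ht).1, (h t ht).2, (h' t ht).2]; abel⟩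

theorem neg (h : HasVelocity z v) : HasVelocity (fun t => -z t) (fun t => -v t) := fun t ht =>
  ⟨(h t ht).1.neg, by
    beta_reduce
    rw [intervalIntegral.integral_neg, (h t ht).2]; abel⟩

theorem sub (h : HasVelocity z v) (h' : HasVelocity w u) :
    HasVelocity (fun t => z t - w t) (fun t => v t - u t) := by
  simpa only [sub_eq_add_neg] using h.add h'.neg

theorem const (a : E) : HasVelocity (fun _ => a) (fun _ => (0 : E)) := fun t _ => by simp

theorem sum {ι : Type*} {s : Finset ι} {z v : ι → ℝ → E}
    (h : ∀ i ∈ s, HasVelocity (z i) (v i)) :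
    HasVelocity (fun t => ∑ i ∈ s, z i t) (fun t => ∑ i ∈ s, v i t) := by
  classical
  induction s using Finset.induction_on with
  | empty => simpa only [Finset.sum_empty] using const (0 : E)
  | insert a s ha ih =>
    simp only [Finset.sum_insert ha]
    exact (h a (by simp)).add (ih fun i hi => h i (by simp [hi]))

theorem of_hasDerivAt [CompleteSpace E] (h : ∀ t, HasDerivAt z (v t) t) (hv : Continuous v) :
    HasVelocity z v := fun t _ =>
  ⟨hv.intervalIntegrable _ _, by
    rw [intervalIntegral.integral_eq_sub_of_hasDerivAt (fun s _ => h s)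
      (hv.intervalIntegrable _ _)]; abel⟩

theorem continuousOn (h : HasVelocity z v) : ContinuousOn z (Set.Ici 0) := by
  intro t (ht : 0 ≤ t)
  have ht' : 0 ≤ t + 1 := by linarith
  have hprim : ContinuousOn (fun s => z 0 + ∫ r in (0 : ℝ)..s, v r) (Set.uIcc 0 (t + 1)) :=
    continuousOn_const.add
      (intervalIntegral.continuousOn_primitive_interval' (h _ ht').1 Set.left_mem_uIcc)
  rw [Set.uIcc_of_le ht'] at hprim
  have hz : ContinuousWithinAt z (Set.Icc 0 (t + 1)) t :=
    (hprim.congr fun s hs => (h s hs.1).2) t ⟨ht, by linarith⟩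
  refine hz.mono_of_mem_nhdsWithin ?_
  rw [← Set.Ici_inter_Iic]
  exact inter_mem self_mem_nhdsWithin (mem_nhdsWithin_of_mem_nhds (Iic_mem_nhds (by linarith)))

theorem map_clm [CompleteSpace E] [CompleteSpace F] (h : HasVelocity z v) (L : E →L[ℝ] F) :
    HasVelocity (fun t => L (z t)) (fun t => L (v t)) := fun t ht => by
  refine ⟨⟨L.integrable_comp (h t ht).1.1, L.integrable_comp (h t ht).1.2⟩, ?_⟩
  beta_reduce
  rw [L.intervalIntegral_comp_comm (h t ht).1, (h t ht).2, map_add]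

theorem mul {z v w u : ℝ → ℝ} (h : HasVelocity z v) (h' : HasVelocity w u) :
    HasVelocity (fun t => z t * w t) (fun t => v t * w t + z t * u t) := by
  intro t ht
  have hsub : Set.uIcc 0 t ⊆ Set.Ici 0 := by
    rw [Set.uIcc_of_le ht]; exact fun s hs => hs.1
  refine ⟨((h t ht).1.mul_continuousOn (h'.continuousOn.mono hsub)).add
    ((h' t ht).1.continuousOn_mul (h.continuousOn.mono hsub)), ?_⟩
  have primitive_ac {z v : ℝ → ℝ} (h : HasVelocity z v) :
      AbsolutelyContinuousOnInterval (fun s => z 0 + ∫ r in (0 : ℝ)..s, v r) 0 t :=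
    ((LipschitzWith.const (z 0)).lipschitzOnWith.absolutelyContinuousOnInterval).fun_add
      ((h t ht).1.absolutelyContinuousOnInterval_intervalIntegral (by simp))
  have parts := (primitive_ac h).integral_deriv_mul_eq_sub (primitive_ac h')
  have hI : ∫ s in (0 : ℝ)..t, (v s * w s + z s * u s) = z t * w t - z 0 * w 0 := by
    rw [(h t ht).2, (h' t ht).2]
    simp only [intervalIntegral.integral_same, add_zero] at parts
    rw [← parts]
    refine intervalIntegral.integral_congr_ae ?_
    filter_upwards [(h t ht).1.ae_hasDerivAt_integral, (h' t ht).1.ae_hasDerivAt_integral]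
      with s hs hs' hst
    have hst' := Set.uIoc_subset_uIcc hst
    have h0 : 0 ≤ s := hsub hst'
    rw [((hs hst' 0 (by simp)).const_add (z 0)).deriv,
      ((hs' hst' 0 (by simp)).const_add (w 0)).deriv, ← (h s h0).2, ← (h' s h0).2]
  rw [hI]; ring

theorem bilin [FiniteDimensional ℝ E] [FiniteDimensional ℝ F] [CompleteSpace G]
    (B : E →L[ℝ] F →L[ℝ] G) {w u : ℝ → F} (h : HasVelocity z v) (h' : HasVelocity w u) :
    HasVelocity (fun t => B (z t) (w t)) (fun t => B (v t) (w t) + B (z t) (u t)) := by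
  have := FiniteDimensional.complete ℝ E
  have := FiniteDimensional.complete ℝ F
  let bE := Module.finBasis ℝ E
  let bF := Module.finBasis ℝ F
  have hB (a : E) (c : F) :
      B a c = ∑ i, ∑ j, (bE.coord i a * bF.coord j c) • B (bE i) (bF j) := by
    conv_lhs => rw [← bE.sum_repr a, ← bF.sum_repr c]
    simp only [map_sum, map_smul, sum_apply, smul_apply, Module.Basis.coord_apply,
      Finset.smul_sum, smul_smul]
    rw [Finset.sum_comm]
    simp only [mul_comm]
  have hsum := sum (s := Finset.univ) fun i _ => sum (s := Finset.univ) fun j _ =>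
    ((h.map_clm (LinearMap.toContinuousLinearMap (bE.coord i))).mul
      (h'.map_clm (LinearMap.toContinuousLinearMap (bF.coord j)))).map_clm
        ((ContinuousLinearMap.id ℝ ℝ).smulRight (B (bE i) (bF j)))
  refine hsum.congr (fun t _ => (hB _ _).symm) fun t _ => ?_
  simp only [hB (v t), hB (z t), ← Finset.sum_add_distrib, ← add_smul]
  rfl

theorem smul [FiniteDimensional ℝ E] {a a' : ℝ → ℝ} (h : HasVelocity a a')
    (h' : HasVelocity z v) :
    HasVelocity (fun t => a t • z t) (fun t => a' t • z t + a t • v t) :=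
  have := FiniteDimensional.complete ℝ E
  bilin (ContinuousLinearMap.lsmul ℝ ℝ) h h'

theorem norm_sq {E : Type*} [NormedAddCommGroup E] [InnerProductSpace ℝ E]
    [FiniteDimensional ℝ E] {z v : ℝ → E} (h : HasVelocity z v) :
    HasVelocity (fun t => ‖z t‖ ^ 2) (fun t => 2 * inner ℝ (z t) (v t)) := by
  refine (bilin (innerSL ℝ) h h).congr (fun t _ => ?_) fun t _ => ?_
  · exact real_inner_self_eq_norm_sq _
  · change inner ℝ (v t) (z t) + inner ℝ (z t) (v t) = _
    rw [real_inner_comm, two_mul]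

theorem norm_sub_sub_smul_le [CompleteSpace E] (h : HasVelocity z v) {a : E} {C s t : ℝ}
    (hs : 0 ≤ s) (hst : s ≤ t) (hC : ∀ r, s ≤ r → r ≤ t → ‖v r - a‖ ≤ C) :
    ‖z t - z s - (t - s) • a‖ ≤ C * (t - s) := by
  have hv := h.intervalIntegrable hs (hs.trans hst)
  rw [h.sub_eq_integral hs (hs.trans hst), ← intervalIntegral.integral_const,
    ← intervalIntegral.integral_sub hv intervalIntegrable_const,
    ← abs_of_nonneg (sub_nonneg.2 hst)]
  refine intervalIntegral.norm_integral_le_of_norm_le_const fun r hr => ?_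
  rw [Set.uIoc_of_le hst] at hr
  exact hC r hr.1.le hr.2

theorem uniformContinuousOn [CompleteSpace E] (h : HasVelocity z v) (hv : BoundedSignal v) :
    UniformContinuousOn z (Set.Ici 0) := by
  obtain ⟨C, hC⟩ := hv
  have lipschitz {s t : ℝ} (hs : 0 ≤ s) (hst : s ≤ t) : dist (z s) (z t) ≤ C * dist s t := by
    rw [dist_comm, dist_comm s, Real.dist_eq, abs_of_nonneg (sub_nonneg.2 hst), dist_eq_norm]
    simpa using h.norm_sub_sub_smul_le (a := 0) hs hst fun r hr _ => by
      simpa using hC r (hs.trans hr)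
  refine (LipschitzOnWith.of_dist_le_mul (K := ⟨C, (norm_nonneg _).trans (hC 0 le_rfl)⟩)
    fun s hs t ht => ?_).uniformContinuousOn
  rcases le_total s t with hst | hst
  · exact lipschitz hs hst
  · rw [dist_comm, dist_comm s]
    exact lipschitz ht hst

end HasVelocity

/-! ### Bounded signals -/

theorem uniformContinuousOn_prodMk {X Y Z : Type*} [UniformSpace X] [UniformSpace Y]
    [UniformSpace Z] {f : X → Y} {g : X → Z} {s : Set X} (hf : UniformContinuousOn f s)
    (hg : UniformContinuousOn g s) : UniformContinuousOn (fun x => (f x, g x)) s :=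
  uniformContinuousOn_iff_restrict.2 <|
    (uniformContinuousOn_iff_restrict.1 hf).prodMk (uniformContinuousOn_iff_restrict.1 hg)

theorem uniformContinuousOn_pi {X Y ι : Type*} [UniformSpace X] [UniformSpace Y]
    {f : ι → X → Y} {s : Set X} (hf : ∀ i, UniformContinuousOn (f i) s) :
    UniformContinuousOn (fun x i => f i x) s :=
  uniformContinuousOn_iff_restrict.2 <|
    uniformContinuous_pi.2 fun i => uniformContinuousOn_iff_restrict.1 (hf i)

namespace BoundedSignal

variable {E F : Type*} [NormedAddCommGroup E] [NormedAddCommGroup F] {z w : ℝ → E}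

theorem const (a : E) : BoundedSignal fun _ : ℝ => a := ⟨‖a‖, fun _ _ => le_rfl⟩

theorem add (hz : BoundedSignal z) (hw : BoundedSignal w) :
    BoundedSignal fun t => z t + w t := by
  obtain ⟨C, hC⟩ := hz
  obtain ⟨D, hD⟩ := hw
  exact ⟨C + D, fun t ht => norm_add_le_of_le (hC t ht) (hD t ht)⟩

theorem sub (hz : BoundedSignal z) (hw : BoundedSignal w) :
    BoundedSignal fun t => z t - w t := by
  obtain ⟨C, hC⟩ := hz
  obtain ⟨D, hD⟩ := hw
  exact ⟨C + D, fun t ht => norm_sub_le_of_le (hC t ht) (hD t ht)⟩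

theorem prodMk {w : ℝ → F} (hz : BoundedSignal z) (hw : BoundedSignal w) :
    BoundedSignal fun t => (z t, w t) := by
  obtain ⟨C, hC⟩ := hz
  obtain ⟨D, hD⟩ := hw
  exact ⟨max C D, fun t ht => max_le_max (hC t ht) (hD t ht)⟩

theorem pi {ι : Type*} [Fintype ι] {z : ι → ℝ → E} (h : ∀ i, BoundedSignal (z i)) :
    BoundedSignal fun t i => z i t := by
  choose C hC using h
  refine ⟨∑ i, |C i|, fun t ht => (pi_norm_le_iff_of_nonneg (by positivity)).2 fun i => ?_⟩
  exact ((hC i t ht).trans (le_abs_self _)).trans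
    (Finset.single_le_sum (f := fun j => |C j|) (fun _ _ => abs_nonneg _) (Finset.mem_univ i))

theorem comp_locallyBounded {f : ℝ → E} (hf : LocallyBounded f) {y : ℝ → ℝ}
    (hy : BoundedSignal y) : BoundedSignal fun t => f (y t) := by
  obtain ⟨R, hR⟩ := hy
  obtain ⟨C, hC⟩ := hf R
  exact ⟨C, fun t ht => hC _ (hR t ht)⟩

theorem continuous_comp [ProperSpace E] {Φ : E → F} (hΦ : Continuous Φ) (hz : BoundedSignal z) :
    BoundedSignal fun t => Φ (z t) := by
  obtain ⟨R, hR⟩ := hz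
  obtain ⟨C, hC⟩ := (isCompact_closedBall (0 : E) R).exists_bound_of_continuousOn hΦ.continuousOn
  exact ⟨C, fun t ht => hC _ (mem_closedBall_zero_iff.2 (hR t ht))⟩

theorem uniformContinuousOn_comp [ProperSpace E] {Φ : E → F} (hΦ : Continuous Φ)
    (hz : BoundedSignal z) (hz' : UniformContinuousOn z (Set.Ici 0)) :
    UniformContinuousOn (fun t => Φ (z t)) (Set.Ici 0) := by
  obtain ⟨R, hR⟩ := hz
  exact ((isCompact_closedBall (0 : E) R).uniformContinuousOn_of_continuous
    hΦ.continuousOn).comp hz' fun t ht => mem_closedBall_zero_iff.2 (hR t ht)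

theorem isBoundedUnder (hz : BoundedSignal z) : IsBoundedUnder (· ≤ ·) atTop (norm ∘ z) := by
  obtain ⟨C, hC⟩ := hz
  exact ⟨C, eventually_map.2 <| (eventually_ge_atTop 0).mono hC⟩

end BoundedSignal

/-! ### Differential inequalities -/

namespace HasVelocity

variable {V v : ℝ → ℝ} {t₀ M η : ℝ}

theorem sub_le_of_velocity_le (h : HasVelocity V v) {a s t : ℝ} (hs : 0 ≤ s) (hst : s ≤ t)
    (hv : ∀ᵐ r, r ∈ Set.Icc s t → v r ≤ a) : V t - V s ≤ a * (t - s) := by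
  rw [h.sub_eq_integral hs (hs.trans hst), mul_comm, ← smul_eq_mul,
    ← intervalIntegral.integral_const]
  exact intervalIntegral.integral_mono_ae_restrict hst
    (h.intervalIntegrable hs (hs.trans hst)) intervalIntegrable_const
    ((ae_restrict_iff' measurableSet_Icc).2 hv)

theorem le_of_velocity_nonpos (h : HasVelocity V v) (ht₀ : 0 ≤ t₀)
    (hv : ∀ᵐ t, t₀ ≤ t → M < V t → v t ≤ 0) (h0 : V t₀ ≤ M) : ∀ t, t₀ ≤ t → V t ≤ M := by
  intro t ht
  by_contra! hlt
  have hcont : ContinuousOn V (Set.Icc t₀ t) := h.continuousOn.mono fun s hs => ht₀.trans hs.1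
  have hcompact : IsCompact (Set.Icc t₀ t ∩ V ⁻¹' Set.Iic M) :=
    isCompact_Icc.of_isClosed_subset
      (hcont.preimage_isClosed_of_isClosed isClosed_Icc isClosed_Iic) Set.inter_subset_left
  obtain ⟨s, ⟨hs, (hsM : V s ≤ M)⟩, hlast⟩ := hcompact.exists_isGreatest ⟨t₀, ⟨le_rfl, ht⟩, h0⟩
  have hle := h.sub_le_of_velocity_le (a := 0) (ht₀.trans hs.1) hs.2 <| by
    filter_upwards [hv, Measure.ae_ne volume s] with r hr hrs hrI
    refine hr (hs.1.trans hrI.1) ?_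
    by_contra! hrM
    exact hrs (le_antisymm (hlast ⟨⟨hs.1.trans hrI.1, hrI.2⟩, hrM⟩) hrI.1)
  linarith

theorem eventually_le_of_velocity_le (h : HasVelocity V v) (ht₀ : 0 ≤ t₀) (hη : 0 < η)
    (hV : ∀ t, 0 ≤ V t) (hv : ∀ᵐ t, t₀ ≤ t → M < V t → v t ≤ -η) :
    ∀ᶠ t in atTop, V t ≤ M := by
  obtain ⟨s, hs, hsM⟩ : ∃ s, t₀ ≤ s ∧ V s ≤ M := by
    by_contra! habove
    have hpos : 0 < (V t₀ + 1) / η := div_pos (by linarith [hV t₀]) hη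
    have hdecr := h.sub_le_of_velocity_le (a := -η) ht₀ (le_add_of_nonneg_right hpos.le) <| by
      filter_upwards [hv] with r hr hrI using hr hrI.1 (habove r hrI.1)
    have : -η * (t₀ + (V t₀ + 1) / η - t₀) = -(V t₀ + 1) := by field_simp; ring
    linarith [hV (t₀ + (V t₀ + 1) / η)]
  filter_upwards [eventually_ge_atTop s] with t ht
  refine h.le_of_velocity_nonpos (ht₀.trans hs) ?_ hsM t ht
  filter_upwards [hv] with r hr hrs hrM
  linarith [hr (hs.trans hrs) hrM]

end HasVelocity

/-! ### Barbalat's lemma -/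

theorem HasVelocity.barbalat {E : Type*} [NormedAddCommGroup E] [NormedSpace ℝ E]
    [CompleteSpace E] {u p r : ℝ → E} (h : HasVelocity u fun t => p t + r t)
    (hu : Tendsto u atTop (𝓝 0)) (hp : UniformContinuousOn p (Set.Ici 0))
    (hr : Tendsto r atTop (𝓝 0)) : Tendsto p atTop (𝓝 0) := by
  rw [Metric.tendsto_nhds]
  intro ε hε
  obtain ⟨δ', hδ', hpδ⟩ := Metric.uniformContinuousOn_iff.1 hp (ε / 4) (by positivity)
  obtain ⟨δ, hδ, hδδ'⟩ := exists_between hδ'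
  have hu' := Metric.tendsto_nhds.1 hu (δ * (ε / 8)) (by positivity)
  have huδ' := (tendsto_atTop_add_const_right atTop δ tendsto_id).eventually hu'
  have hr' := eventually_forall_ge_atTop.2 (Metric.tendsto_nhds.1 hr (ε / 4) (by positivity))
  filter_upwards [eventually_ge_atTop 0, hu', huδ', hr'] with t ht hut huδ hrt
  simp only [dist_zero_right, id] at hut huδ hrt ⊢
  have hdrift : ‖u (t + δ) - u t - (t + δ - t) • p t‖ ≤ ε / 2 * (t + δ - t) := by
    refine h.norm_sub_sub_smul_le ht (by linarith) fun s hs hsδ => ?_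
    have hps := hpδ s (ht.trans hs) t ht
      (by rw [Real.dist_eq, abs_of_nonneg (by linarith)]; linarith)
    rw [dist_eq_norm] at hps
    calc ‖p s + r s - p t‖ = ‖(p s - p t) + r s‖ := by congr 1; abel
      _ ≤ ε / 2 := (norm_add_le _ _).trans (by linarith [hrt s hs])
  rw [add_sub_cancel_left] at hdrift
  refine lt_of_mul_lt_mul_left ?_ hδ.le
  calc δ * ‖p t‖ = ‖δ • p t‖ := by rw [norm_smul, Real.norm_of_nonneg hδ.le]
    _ = ‖(u (t + δ) - u t) - (u (t + δ) - u t - δ • p t)‖ := by congr 1; abel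
    _ ≤ (‖u (t + δ)‖ + ‖u t‖) + ε / 2 * δ :=
      (norm_sub_le _ _).trans (add_le_add (norm_sub_le _ _) hdrift)
    _ < δ * ε := by nlinarith

theorem HasVelocity.tendsto_zero_of_velocity_le_neg {V v W : ℝ → ℝ} (h : HasVelocity V v)
    (hV : ∀ t, 0 ≤ t → 0 ≤ V t) (hW : UniformContinuousOn W (Set.Ici 0))
    (hWnn : ∀ t, 0 ≤ t → 0 ≤ W t) (hv : ∀ t, 0 ≤ t → v t ≤ -W t) :
    Tendsto W atTop (𝓝 0) := by
  have hint {s t : ℝ} (hs : 0 ≤ s) (ht : 0 ≤ t) : IntervalIntegrable W volume s t :=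
    (hW.continuousOn.mono fun r hr => (le_min hs ht).trans hr.1).intervalIntegrable
  let U : ℝ → ℝ := fun t => ∫ s in (0 : ℝ)..max t 0, W s
  have hU : HasVelocity U W := fun t ht =>
    ⟨hint le_rfl ht, by simp [U, max_eq_left ht]⟩
  have hmono : Monotone U := fun s t hst => by
    have h0 : 0 ≤ max s 0 := le_max_right _ _
    have hst' : max s 0 ≤ max t 0 := max_le_max hst le_rfl
    have hnn : 0 ≤ ∫ r in (max s 0)..(max t 0), W r :=
      intervalIntegral.integral_nonneg hst' fun r hr => hWnn r (h0.trans hr.1)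
    rw [← intervalIntegral.integral_interval_sub_left (hint le_rfl (h0.trans hst'))
      (hint le_rfl h0)] at hnn
    exact sub_nonneg.1 hnn
  have hbdd : BddAbove (Set.range U) := by
    refine ⟨V 0, Set.forall_mem_range.2 fun t => ?_⟩
    have h0 : 0 ≤ max t 0 := le_max_right _ _
    have hVU := (h.add hU).sub_le_of_velocity_le (a := 0) le_rfl h0 <|
      .of_forall fun r hr => by linarith [hv r hr.1]
    have hU0 : U 0 = 0 := by simp [U]
    have hUt : U (max t 0) = U t := by simp [U]
    linarith [hV _ h0]
  have hlim := (tendsto_atTop_ciSup hmono hbdd).sub_const (⨆ t, U t)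
  rw [sub_self] at hlim
  exact ((hU.sub (.const _)).congr_velocity (v' := fun t => W t + 0) fun t _ => by simp).barbalat
    hlim hW tendsto_const_nhds

/-! ### Hurwitz linear systems -/

section ScalarLinear

variable {u w : ℝ → ℂ} {μ : ℂ}

theorem HasVelocity.norm_sq_of_linear (h : HasVelocity u fun t => μ * u t + w t) :
    HasVelocity (fun t => ‖u t‖ ^ 2)
      (fun t => 2 * (μ.re * ‖u t‖ ^ 2 + inner ℝ (u t) (w t))) := by
  refine h.norm_sq.congr_velocity fun t _ => ?_
  rw [inner_add_right, ← Complex.normSq_eq_norm_sq, Complex.normSq_apply]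
  simp only [Complex.inner, Complex.mul_re, Complex.mul_im, Complex.conj_re,
    Complex.conj_im]
  ring

theorem HasVelocity.boundedSignal_of_linear (hμ : μ.re < 0)
    (h : HasVelocity u fun t => μ * u t + w t) (hw : BoundedSignal w) : BoundedSignal u := by
  obtain ⟨C, hC⟩ := hw
  refine ⟨max ‖u 0‖ (C / -μ.re), fun t ht => ?_⟩
  have hM : 0 ≤ max ‖u 0‖ (C / -μ.re) := (norm_nonneg _).trans (le_max_left _ _)
  refine le_of_sq_le_sq ?_ hM
  refine h.norm_sq_of_linear.le_of_velocity_nonpos le_rfl (.of_forall fun s hs hlt => ?_)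
    (pow_le_pow_left₀ (norm_nonneg _) (le_max_left _ _) 2) t ht
  have hus : C / -μ.re ≤ ‖u s‖ := (le_max_right _ _).trans (lt_of_pow_lt_pow_left₀ 2
    (norm_nonneg _) hlt).le
  rw [div_le_iff₀ (neg_pos.2 hμ)] at hus
  have hin : inner ℝ (u s) (w s) ≤ ‖u s‖ * C :=
    (real_inner_le_norm _ _).trans (mul_le_mul_of_nonneg_left (hC s hs) (norm_nonneg _))
  nlinarith [norm_nonneg (u s)]

theorem HasVelocity.tendsto_zero_of_linear (hμ : μ.re < 0)
    (h : HasVelocity u fun t => μ * u t + w t) (hw : Tendsto w atTop (𝓝 0)) :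
    Tendsto u atTop (𝓝 0) := by
  refine Metric.nhds_basis_closedBall.tendsto_right_iff.2 fun ε hε => ?_
  have hσ : 0 < -μ.re := neg_pos.2 hμ
  obtain ⟨t₀, ht₀⟩ := eventually_atTop.1 <|
    Metric.nhds_basis_closedBall.tendsto_right_iff.1 hw (ε / 2 * -μ.re) (by positivity)
  have hev := h.norm_sq_of_linear.eventually_le_of_velocity_le (M := ε ^ 2) (η := -μ.re * ε ^ 2)
    (le_max_right t₀ 0) (by positivity) (fun t => by positivity)
    (.of_forall fun s hs hlt => ?_)
  · filter_upwards [hev] with t ht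
    exact mem_closedBall_zero_iff.2 (le_of_sq_le_sq ht hε.le)
  · have hws := mem_closedBall_zero_iff.1 (ht₀ s ((le_max_left _ _).trans hs))
    have hus : ε < ‖u s‖ := lt_of_pow_lt_pow_left₀ 2 (norm_nonneg _) hlt
    have hin : inner ℝ (u s) (w s) ≤ ‖u s‖ * (ε / 2 * -μ.re) :=
      (real_inner_le_norm _ _).trans (mul_le_mul_of_nonneg_left hws (norm_nonneg _))
    nlinarith [mul_lt_mul_of_pos_left hus hσ, mul_pos hσ hε]

end ScalarLinear

section Hurwitz

variable {ι : Type*} [Fintype ι]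

theorem HasVelocity.dotProduct {𝕜 : Type*} [NormedCommRing 𝕜] [NormedAlgebra ℝ 𝕜]
    [FiniteDimensional ℝ 𝕜] {z v : ℝ → ι → 𝕜} (h : HasVelocity z v) (c : ι → 𝕜) :
    HasVelocity (fun t => c ⬝ᵥ z t) (fun t => c ⬝ᵥ v t) :=
  have := FiniteDimensional.complete ℝ 𝕜
  h.map_clm (dotProductBilin ℝ ℝ c).toContinuousLinearMap

variable {M : Matrix ι ι ℂ} {z w : ℝ → ι → ℂ}

theorem HasVelocity.dotProduct_linear (h : HasVelocity z fun t => M *ᵥ z t + w t)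
    (μ : ℂ) (l : ι → ℂ) :
    HasVelocity (fun t => l ⬝ᵥ z t)
      (fun t => μ * (l ⬝ᵥ z t) + ((l ᵥ* M - μ • l) ⬝ᵥ z t + l ⬝ᵥ w t)) := by
  refine (h.dotProduct l).congr_velocity fun t _ => ?_
  simp only [dotProduct_add, sub_dotProduct, smul_dotProduct, ← Matrix.dotProduct_mulVec,
    smul_eq_mul]
  ring

-- The characteristic polynomial annihilates `M` and splits, so its linear factors can be peeled
-- off `l ᵥ* M.charpoly(M) = 0` one eigenvalue at a time.
theorem forall_covector_of_spectrum {K : Type*} [Field K] [IsAlgClosed K] [DecidableEq ι]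
    (M : Matrix ι ι K) {p : (ι → K) → Prop} (zero : p 0)
    (peel : ∀ μ ∈ spectrum K M, ∀ l, p (l ᵥ* M - μ • l) → p l) (l : ι → K) : p l := by
  have of_aeval_prod (s : Multiset K) : (∀ μ ∈ s, μ ∈ spectrum K M) → ∀ l : ι → K,
      p (l ᵥ* Polynomial.aeval M (s.map fun a => Polynomial.X - Polynomial.C a).prod) →
        p l := by
    induction s using Multiset.induction_on with
    | empty => intro _ l hl; simpa using hl
    | cons a s ih =>
      intro hs l hl
      refine peel a (hs a (by simp)) l (ih (fun μ hμ => hs μ (by simp [hμ])) _ ?_)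
      rw [Multiset.map_cons, Multiset.prod_cons, map_mul, ← Matrix.vecMul_vecMul] at hl
      simpa [Matrix.vecMul_sub, Algebra.algebraMap_eq_smul_one, Matrix.vecMul_smul] using hl
  refine of_aeval_prod M.charpoly.roots (fun μ hμ => ?_) l ?_
  · exact Matrix.mem_spectrum_iff_isRoot_charpoly.2 (Polynomial.isRoot_of_mem_roots hμ)
  · rw [← (IsAlgClosed.splits M.charpoly).eq_prod_roots_of_monic M.charpoly_monic,
      Matrix.aeval_self_charpoly, Matrix.vecMul_zero]
    exact zero

theorem HasVelocity.boundedSignal_dotProduct [DecidableEq ι] (hM : ∀ s ∈ spectrum ℂ M, s.re < 0)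
    (h : HasVelocity z fun t => M *ᵥ z t + w t) (hw : ∀ l, BoundedSignal fun t => l ⬝ᵥ w t)
    (l : ι → ℂ) : BoundedSignal fun t => l ⬝ᵥ z t :=
  forall_covector_of_spectrum M (p := fun l => BoundedSignal fun t => l ⬝ᵥ z t)
    (by simpa only [zero_dotProduct] using BoundedSignal.const (0 : ℂ))
    (fun μ hμ l hl => (h.dotProduct_linear μ l).boundedSignal_of_linear (hM μ hμ) (hl.add (hw l))) l

theorem tendsto_dotProduct_zero (hw : Tendsto w atTop (𝓝 0)) (l : ι → ℂ) :
    Tendsto (fun t => l ⬝ᵥ w t) atTop (𝓝 0) := by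
  have hl : Continuous fun x => l ⬝ᵥ x := by fun_prop
  simpa [Function.comp_def] using (hl.tendsto 0).comp hw

theorem HasVelocity.tendsto_zero_dotProduct [DecidableEq ι] (hM : ∀ s ∈ spectrum ℂ M, s.re < 0)
    (h : HasVelocity z fun t => M *ᵥ z t + w t)
    (hw : ∀ l, Tendsto (fun t => l ⬝ᵥ w t) atTop (𝓝 0)) (l : ι → ℂ) :
    Tendsto (fun t => l ⬝ᵥ z t) atTop (𝓝 0) :=
  forall_covector_of_spectrum M (p := fun l => Tendsto (fun t => l ⬝ᵥ z t) atTop (𝓝 0))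
    (by simp only [zero_dotProduct, tendsto_const_nhds])
    (fun μ hμ l hl => (h.dotProduct_linear μ l).tendsto_zero_of_linear (hM μ hμ)
      (by simpa only [add_zero] using hl.add (hw l))) l

/-- The inclusion of `ℝⁿ` into `ℂⁿ`, through which the eigenvalues of a real system act. -/
noncomputable def complexify : (ι → ℝ) →L[ℝ] (ι → ℂ) :=
  ContinuousLinearMap.pi fun i => Complex.ofRealCLM.comp (ContinuousLinearMap.proj i)

omit [Fintype ι] in
theorem complexify_apply (z : ι → ℝ) : complexify z = fun i => (z i : ℂ) := rfl

theorem complexify_mulVec (F : Matrix ι ι ℝ) (z : ι → ℝ) :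
    complexify (F *ᵥ z) = F.map Complex.ofReal *ᵥ complexify z := by
  ext i
  simp [complexify_apply, Matrix.mulVec, dotProduct]

theorem complexify_dotProduct_complexify (c z : ι → ℝ) :
    complexify c ⬝ᵥ complexify z = ((c ⬝ᵥ z : ℝ) : ℂ) := by
  simp [complexify_apply, dotProduct]

variable {n : ℕ} {F : Matrix (Fin n) (Fin n) ℝ} {z w : ℝ → Fin n → ℝ}

theorem HasVelocity.complexify (h : HasVelocity z fun t => F *ᵥ z t + w t) :
    HasVelocity (fun t => complexify (z t))
      (fun t => F.map Complex.ofReal *ᵥ complexify (z t) + AdaptiveSync.complexify (w t)) :=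
  (h.map_clm _).congr_velocity fun t _ => by rw [map_add, complexify_mulVec]

theorem IsHurwitz.boundedSignal (hF : IsHurwitz F) (h : HasVelocity z fun t => F *ᵥ z t + w t)
    (hw : BoundedSignal w) : BoundedSignal z := by
  have hlz := h.complexify.boundedSignal_dotProduct hF fun l =>
    hw.continuous_comp (Φ := fun x => l ⬝ᵥ AdaptiveSync.complexify x) (by fun_prop)
  refine BoundedSignal.pi fun i => (hlz (Pi.single i 1)).imp fun C hC t ht => ?_
  simpa [complexify_apply] using hC t ht

theorem IsHurwitz.tendsto_zero (hF : IsHurwitz F) (h : HasVelocity z fun t => F *ᵥ z t + w t)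
    (hw : Tendsto w atTop (𝓝 0)) : Tendsto z atTop (𝓝 0) := by
  have hlz := h.complexify.tendsto_zero_dotProduct hF <| tendsto_dotProduct_zero <|
    (AdaptiveSync.complexify.continuous.tendsto' 0 0 (map_zero _)).comp hw
  refine tendsto_pi_nhds.2 fun i => ?_
  simpa [complexify_apply, Function.comp_def] using
    (Complex.continuous_re.tendsto 0).comp (hlz (Pi.single i 1))

theorem IsHurwitz.uniformContinuousOn (hF : IsHurwitz F)
    (h : HasVelocity z fun t => F *ᵥ z t + w t) (hw : BoundedSignal w) :
    UniformContinuousOn z (Set.Ici 0) :=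
  h.uniformContinuousOn <|
    ((hF.boundedSignal h hw).continuous_comp F.mulVecLin.toContinuousLinearMap.continuous).add hw

theorem IsHurwitz.exists_pos_add_smul_one (hF : IsHurwitz F) :
    ∃ a : ℝ, 0 < a ∧ IsHurwitz (F + a • 1) := by
  have hfin : (spectrum ℂ (F.map Complex.ofReal)).Finite := Matrix.finite_spectrum _
  have hstable : ∀ᶠ a in 𝓝[>] (0 : ℝ), ∀ μ ∈ spectrum ℂ (F.map Complex.ofReal), μ.re < -a := by
    rw [hfin.eventually_all]
    intro μ hμ
    filter_upwards [nhdsWithin_le_nhds (Iio_mem_nhds (neg_pos.2 (hF μ hμ)))] with a ha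
      using lt_neg_of_lt_neg ha
  obtain ⟨a, hspec, ha⟩ := (hstable.and self_mem_nhdsWithin).exists
  refine ⟨a, ha, fun s hs => ?_⟩
  have hshift : (F + a • 1).map Complex.ofReal
      = algebraMap ℂ (Matrix (Fin n) (Fin n) ℂ) a + F.map Complex.ofReal := by
    rw [add_comm F]
    ext i j
    simp [Matrix.algebraMap_matrix_apply, Matrix.one_apply, apply_ite Complex.ofReal]
  rw [hshift, ← sub_add_cancel s (a : ℂ), spectrum.add_mem_add_iff] at hs
  have := hspec _ hs
  simp only [Complex.sub_re, Complex.ofReal_re] at this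
  linarith

theorem IsHurwitz.exists_exp_decay (hF : IsHurwitz F) (h : HasVelocity z fun t => F *ᵥ z t) :
    ∃ a C : ℝ, 0 < a ∧ ∀ t, 0 ≤ t → ‖z t‖ ≤ C * Real.exp (-a * t) := by
  obtain ⟨a, ha, hFa⟩ := hF.exists_pos_add_smul_one
  have hexp : HasVelocity (fun t => Real.exp (a * t)) (fun t => a * Real.exp (a * t)) :=
    .of_hasDerivAt (fun t => by
      simpa [mul_comm] using ((hasDerivAt_id t).const_mul a).exp) (by fun_prop)
  obtain ⟨C, hC⟩ := hFa.boundedSignal (w := fun _ => 0)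
    ((hexp.smul h).congr_velocity fun t _ => by
      rw [Matrix.add_mulVec, Matrix.mulVec_smul, Matrix.smul_mulVec, Matrix.one_mulVec]
      module) (.const 0)
  refine ⟨a, C, ha, fun t ht => ?_⟩
  have := hC t ht
  rw [norm_smul, Real.norm_of_nonneg (Real.exp_pos _).le] at this
  rwa [neg_mul, Real.exp_neg, ← div_eq_mul_inv, le_div_iff₀' (Real.exp_pos _)]

end Hurwitz

/-! ### Admissible inputs -/

/-- An input signal that is measurable and bounded on `[0, ∞)`, the class of signals for which the
linear filters and the adaptation law have solutions on `[0, ∞)`. Measurability is up to null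
sets of `[0, ∞)`, as for the measurement noise. -/
structure IsAdmissible {E : Type*} [NormedAddCommGroup E] (w : ℝ → E) : Prop where
  aestronglyMeasurable : AEStronglyMeasurable w (volume.restrict (Set.Ici 0))
  boundedSignal : BoundedSignal w

namespace IsAdmissible

variable {E F : Type*} [NormedAddCommGroup E] [NormedAddCommGroup F] {z w : ℝ → E}

theorem of_hasVelocity [NormedSpace ℝ E] {v : ℝ → E} (h : HasVelocity z v)
    (hz : BoundedSignal z) : IsAdmissible z :=
  ⟨h.continuousOn.aestronglyMeasurable measurableSet_Ici, hz⟩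

theorem add (hz : IsAdmissible z) (hw : IsAdmissible w) : IsAdmissible fun t => z t + w t :=
  ⟨hz.1.add hw.1, hz.2.add hw.2⟩

theorem sub (hz : IsAdmissible z) (hw : IsAdmissible w) : IsAdmissible fun t => z t - w t :=
  ⟨hz.1.sub hw.1, hz.2.sub hw.2⟩

theorem prodMk {w : ℝ → F} (hz : IsAdmissible z) (hw : IsAdmissible w) :
    IsAdmissible fun t => (z t, w t) :=
  ⟨hz.1.prodMk hw.1, hz.2.prodMk hw.2⟩

theorem continuous_comp [ProperSpace E] {Φ : E → F} (hΦ : Continuous Φ) (hz : IsAdmissible z) :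
    IsAdmissible fun t => Φ (z t) :=
  ⟨hΦ.comp_aestronglyMeasurable hz.1, hz.2.continuous_comp hΦ⟩

theorem comp_locallyBounded [MeasurableSpace E] [BorelSpace E] [SecondCountableTopology E]
    {f : ℝ → E} (hf : Measurable f) (hfb : LocallyBounded f) {y : ℝ → ℝ} (hy : IsAdmissible y) :
    IsAdmissible fun t => f (y t) :=
  ⟨(hf.comp_aemeasurable hy.1.aemeasurable).aestronglyMeasurable, hy.2.comp_locallyBounded hfb⟩

end IsAdmissible

/-! ### Global existence for Carathéodory equations -/

section Existence

open scoped NNReal BoundedContinuousFunction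

variable {E : Type*} [NormedAddCommGroup E] [NormedSpace ℝ E]

/-- A time-varying vector field on `[0, ∞)` that is uniformly Lipschitz with constant `K`, bounded
by `C` at the origin, and measurable along continuous curves: the hypotheses under which
`ż = G t z` is solvable on all of `[0, ∞)` in the sense of Carathéodory. -/
structure IsCaratheodoryField (G : ℝ → E → E) (K : ℝ≥0) (C : ℝ) : Prop where
  aestronglyMeasurable : ∀ z : ℝ → E, Continuous z →
    AEStronglyMeasurable (fun t => G t (z t)) (volume.restrict (Set.Ici 0))
  lipschitzWith : ∀ t, 0 ≤ t → LipschitzWith K (G t)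
  norm_zero_le : ∀ t, 0 ≤ t → ‖G t 0‖ ≤ C

theorem norm_exp_smul_integral_le {g : ℝ → E} {A a t : ℝ} (ha : 0 < a) (hA : 0 ≤ A)
    (ht : 0 ≤ t) (hg : ∀ s, 0 ≤ s → ‖g s‖ ≤ A * Real.exp (a * s)) :
    ‖Real.exp (-(a * t)) • ∫ s in (0 : ℝ)..t, g s‖ ≤ A / a := by
  have hexp : Continuous fun s => A * Real.exp (a * s) := by fun_prop
  have hint : ∫ s in (0 : ℝ)..t, A * Real.exp (a * s) = A / a * (Real.exp (a * t) - 1) := by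
    rw [intervalIntegral.integral_const_mul, intervalIntegral.integral_comp_mul_left _ ha.ne',
      integral_exp, mul_zero, Real.exp_zero, smul_eq_mul]
    ring
  have hle : ‖∫ s in (0 : ℝ)..t, g s‖ ≤ A / a * (Real.exp (a * t) - 1) :=
    hint ▸ intervalIntegral.norm_integral_le_of_norm_le ht
      (.of_forall fun s hs => hg s hs.1.le) (hexp.intervalIntegrable _ _)
  rw [norm_smul, Real.norm_of_nonneg (Real.exp_pos _).le, Real.exp_neg,
    inv_mul_le_iff₀ (Real.exp_pos _)]
  linarith [div_nonneg hA ha.le]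

namespace IsCaratheodoryField

variable {G : ℝ → E → E} {K : ℝ≥0} {C a : ℝ}

omit [NormedSpace ℝ E] in
theorem norm_le (hG : IsCaratheodoryField G K C) {t : ℝ} (ht : 0 ≤ t) (p : E) :
    ‖G t p‖ ≤ C + K * ‖p‖ := by
  have hdist := (hG.lipschitzWith t ht).norm_sub_le p 0
  rw [sub_zero] at hdist
  linarith [norm_le_norm_add_norm_sub (G t 0) (G t p), hG.norm_zero_le t ht,
    norm_sub_rev (G t 0) (G t p)]

omit [NormedSpace ℝ E] in
theorem bound_nonneg (hG : IsCaratheodoryField G K C) : 0 ≤ C :=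
  (norm_nonneg _).trans (hG.norm_zero_le 0 le_rfl)

theorem norm_exp_smul_le (hG : IsCaratheodoryField G K C) (ha : 0 < a) (w : ℝ →ᵇ E) {t : ℝ}
    (ht : 0 ≤ t) :
    ‖G t (Real.exp (a * t) • w t)‖ ≤ (C + K * ‖w‖) * Real.exp (a * t) := by
  have hexp : 1 ≤ Real.exp (a * t) := Real.one_le_exp (mul_nonneg ha.le ht)
  refine (hG.norm_le ht _).trans ?_
  rw [norm_smul, Real.norm_of_nonneg (Real.exp_pos _).le, add_mul, mul_right_comm, mul_assoc]
  gcongr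
  · exact le_mul_of_one_le_right hG.bound_nonneg hexp
  · exact w.norm_coe_le_norm t

theorem hasVelocity_integral (hG : IsCaratheodoryField G K C) (z₀ : E) {z : ℝ → E}
    (hz : Continuous z) :
    HasVelocity (fun t => z₀ + ∫ s in (0 : ℝ)..t, G s (z s)) (fun t => G t (z t)) := by
  refine fun t ht => ⟨?_, by simp⟩
  have hbound : Continuous fun s => C + K * ‖z s‖ := by fun_prop
  have hsub : Set.uIoc 0 t ⊆ Set.Ici 0 := by
    rw [Set.uIoc_of_le ht]
    exact fun s hs => hs.1.le
  refine (hbound.intervalIntegrable 0 t).mono_fun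
    ((hG.aestronglyMeasurable z hz).mono_measure (Measure.restrict_mono hsub le_rfl))
    ((ae_restrict_iff' measurableSet_uIoc).2 (.of_forall fun s hs => ?_))
  exact (hG.norm_le (hsub hs) _).trans (le_abs_self _)

/-- The Picard operator of `ż = G t z`, `z 0 = z₀`, in the coordinate `w t = exp (-a t) z t`, whose
sup norm is Bielecki's weighted norm of `z`; times `t ≤ 0` are frozen at the initial value. -/
noncomputable def picard [CompleteSpace E] (hG : IsCaratheodoryField G K C) (ha : 0 < a) (z₀ : E)
    (w : ℝ →ᵇ E) : ℝ →ᵇ E :=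
  .ofNormedAddCommGroup
    (fun t => Real.exp (-(a * max t 0)) •
      (z₀ + ∫ s in (0 : ℝ)..max t 0, G s (Real.exp (a * s) • w s)))
    ((by fun_prop : Continuous fun t => Real.exp (-(a * max t 0))).smul
      ((hG.hasVelocity_integral z₀ (by fun_prop)).continuousOn.comp_continuous
        (by fun_prop : Continuous fun t : ℝ => max t 0)
        fun _ => Set.mem_Ici.2 (le_max_right _ _)))
    (‖z₀‖ + (C + K * ‖w‖) / a) fun t => by
      have hC := hG.bound_nonneg
      rw [smul_add]
      refine norm_add_le_of_le ?_ (norm_exp_smul_integral_le ha (by positivity)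
        (le_max_right _ _) fun s hs => hG.norm_exp_smul_le ha w hs)
      rw [norm_smul, Real.norm_of_nonneg (Real.exp_pos _).le]
      refine mul_le_of_le_one_left (norm_nonneg _) (Real.exp_le_one_iff.2 ?_)
      exact neg_nonpos.2 (mul_nonneg ha.le (le_max_right _ _))

variable [CompleteSpace E]

theorem picard_apply (hG : IsCaratheodoryField G K C) (ha : 0 < a) (z₀ : E) (w : ℝ →ᵇ E) (t : ℝ) :
    hG.picard ha z₀ w t = Real.exp (-(a * max t 0)) •
      (z₀ + ∫ s in (0 : ℝ)..max t 0, G s (Real.exp (a * s) • w s)) := rfl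

theorem dist_picard_le (hG : IsCaratheodoryField G K C) (ha : 0 < a) (z₀ : E) (w w' : ℝ →ᵇ E) :
    dist (hG.picard ha z₀ w) (hG.picard ha z₀ w') ≤ K / a * dist w w' := by
  refine (BoundedContinuousFunction.dist_le (by positivity)).2 fun t => ?_
  have ht : 0 ≤ max t 0 := le_max_right _ _
  have integrable (w : ℝ →ᵇ E) : IntervalIntegrable
      (fun s => G s (Real.exp (a * s) • w s)) volume 0 (max t 0) :=
    (hG.hasVelocity_integral z₀ (by fun_prop) _ ht).1
  rw [dist_eq_norm, picard_apply, picard_apply, ← smul_sub, add_sub_add_left_eq_sub,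
    ← intervalIntegral.integral_sub (integrable w) (integrable w'), div_mul_eq_mul_div]
  refine norm_exp_smul_integral_le ha (by positivity) ht fun s hs => ?_
  refine ((hG.lipschitzWith s hs).norm_sub_le _ _).trans ?_
  rw [← smul_sub, norm_smul, Real.norm_of_nonneg (Real.exp_pos _).le, mul_assoc, ← dist_eq_norm,
    mul_comm (dist w w')]
  gcongr
  exact BoundedContinuousFunction.dist_coe_le_dist s

theorem exists_hasVelocity (hG : IsCaratheodoryField G K C) (z₀ : E) :
    ∃ z : ℝ → E, HasVelocity z (fun t => G t (z t)) ∧ z 0 = z₀ := by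
  have ha : 0 < 2 * (K : ℝ) + 1 := by positivity
  have hcontract : ContractingWith (1 / 2) (hG.picard ha z₀) := by
    refine ⟨by rw [← NNReal.coe_lt_coe]; norm_num, .of_dist_le_mul fun w w' => ?_⟩
    refine (hG.dist_picard_le ha z₀ w w').trans ?_
    gcongr
    rw [div_le_iff₀ ha]
    push_cast
    linarith
  set w := hcontract.fixedPoint
  have hw (t : ℝ) (ht : 0 ≤ t) :
      z₀ + ∫ s in (0 : ℝ)..t, G s (Real.exp ((2 * K + 1) * s) • w s)
        = Real.exp ((2 * K + 1) * t) • w t := by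
    have hfix : hG.picard ha z₀ w t = w t := by rw [hcontract.fixedPoint_isFixedPt]
    rw [← hfix, picard_apply, max_eq_left ht, smul_smul, ← Real.exp_add, add_neg_cancel,
      Real.exp_zero, one_smul]
  refine ⟨fun t => Real.exp ((2 * K + 1) * t) • w t,
    (hG.hasVelocity_integral z₀ (by fun_prop)).congr hw fun t _ => rfl, ?_⟩
  beta_reduce
  rw [← hw 0 le_rfl, intervalIntegral.integral_same, add_zero]

end IsCaratheodoryField

theorem IsAdmissible.exists_linear_response {n : ℕ} (F : Matrix (Fin n) (Fin n) ℝ)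
    {w : ℝ → Fin n → ℝ} (hw : IsAdmissible w) (z₀ : Fin n → ℝ) :
    ∃ z : ℝ → Fin n → ℝ, HasVelocity z (fun t => F *ᵥ z t + w t) ∧ z 0 = z₀ := by
  obtain ⟨C, hC⟩ := hw.boundedSignal
  let L : (Fin n → ℝ) →L[ℝ] (Fin n → ℝ) := F.mulVecLin.toContinuousLinearMap
  have hG : IsCaratheodoryField (fun t z => F *ᵥ z + w t) ‖L‖₊ C :=
    { aestronglyMeasurable := fun z hz => (L.continuous.comp hz).aestronglyMeasurable.add hw.1
      lipschitzWith := fun t _ => (L.lipschitz.add (.const (w t))).weaken (by simp)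
      norm_zero_le := fun t ht => by simpa using hC t ht }
  exact hG.exists_hasVelocity z₀

end Existence

/-! ### Inversion of minimum phase systems -/

section MinimumPhase

variable {ι K : Type*} [Fintype ι] [DecidableEq ι] [Field K] {M : Matrix ι ι K} {b c k : ι → K}
  {s : K} {S : Submodule K (ι → K)}

theorem exists_dotProduct_ne_zero_of_transfer_ne_zero (hdet : IsUnit (s • 1 - M).det)
    (hs : c ⬝ᵥ ((s • 1 - M)⁻¹ *ᵥ b) ≠ 0) (hc : c ∈ S)
    (hS : ∀ l ∈ S, l ⬝ᵥ b = 0 → l ᵥ* M ∈ S) : ∃ l ∈ S, l ⬝ᵥ b ≠ 0 := by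
  by_contra! hb
  set N := s • 1 - M
  have hNS (l) (hl : l ∈ S) : N.vecMulLinear l ∈ S := by
    rw [Matrix.vecMulLinear_apply, Matrix.vecMul_sub, Matrix.vecMul_smul, Matrix.vecMul_one]
    exact S.sub_mem (S.smul_mem s hl) (hS l hl (hb l hl))
  have hinj : Function.Injective (N.vecMulLinear.restrict hNS) := fun l l' h =>
    Subtype.ext (Matrix.vecMul_injective_of_isUnit ((Matrix.isUnit_iff_isUnit_det N).2 hdet)
      (congrArg Subtype.val h))
  obtain ⟨l, hl⟩ := LinearMap.injective_iff_surjective.1 hinj ⟨c, hc⟩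
  have hlc : (l : ι → K) ᵥ* N = c := congrArg Subtype.val hl
  apply hs
  rw [← hlc, Matrix.dotProduct_mulVec, Matrix.vecMul_vecMul, Matrix.mul_nonsing_inv N hdet,
    Matrix.vecMul_one, hb l l.2]

/- An eigenvector `w` of the feedback matrix satisfies `(s I - M) w = -(kᵀ w) b`, so that
`cᵀ w = -(kᵀ w) H(s)`. -/
theorem eq_zero_of_feedback_mulVec_eq_smul (hdet : IsUnit (s • 1 - M).det)
    (hs : c ⬝ᵥ ((s • 1 - M)⁻¹ *ᵥ b) ≠ 0) {w : ι → K}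
    (hw : (M - Matrix.vecMulVec b k) *ᵥ w = s • w) (hcw : c ⬝ᵥ w = 0) : w = 0 := by
  have hNw : (s • 1 - M) *ᵥ w = (-(k ⬝ᵥ w)) • b := by
    rw [Matrix.sub_mulVec, Matrix.smul_mulVec, Matrix.one_mulVec, ← hw, Matrix.sub_mulVec,
      Matrix.vecMulVec_mulVec, op_smul_eq_smul, sub_sub_cancel_left, neg_smul]
  have hw' : w = (-(k ⬝ᵥ w)) • ((s • 1 - M)⁻¹ *ᵥ b) := by
    rw [← Matrix.mulVec_smul, ← hNw, Matrix.mulVec_mulVec, Matrix.nonsing_inv_mul _ hdet,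
      Matrix.one_mulVec]
  rw [hw', dotProduct_smul, smul_eq_mul] at hcw
  rw [hw', (mul_eq_zero.1 hcw).resolve_right hs, zero_smul]

omit [DecidableEq ι] in
theorem exists_ne_zero_forall_dotProduct_eq_zero (hS : S ≠ ⊤) :
    ∃ w : ι → K, w ≠ 0 ∧ ∀ l ∈ S, l ⬝ᵥ w = 0 := by
  classical
  obtain ⟨ψ, hψ, hle⟩ := S.exists_le_ker_of_lt_top (lt_top_iff_ne_top.2 hS)
  obtain ⟨w, rfl⟩ := (dotProductEquiv K ι).surjective ψ
  exact ⟨w, fun hw => hψ (by rw [hw, map_zero]), fun l hl =>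
    (dotProduct_comm l w).trans (hle hl)⟩

theorem mem_of_map_mem {V : Type*} [AddCommGroup V] [Module K V] [FiniteDimensional K V]
    {f : V →ₗ[K] V} {S : Submodule K V} (hfS : S ≤ S.comap f) (htop : LinearMap.range f ⊔ S = ⊤)
    {l : V} (hl : f l ∈ S) : l ∈ S := by
  have hsurj : Function.Surjective (S.mapQ S f hfS) := by
    rw [← LinearMap.range_eq_top, Submodule.range_mapQ, Submodule.map_mkQ_eq_top, sup_comm, htop]
  have hinj := LinearMap.injective_iff_surjective.2 hsurj
  rw [← Submodule.Quotient.mk_eq_zero] at hl ⊢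
  exact hinj (hl.trans (map_zero _).symm)

theorem mem_of_vecMul_feedback_sub_smul_mem (hdet : IsUnit (s • 1 - M).det)
    (hs : c ⬝ᵥ ((s • 1 - M)⁻¹ *ᵥ b) ≠ 0) (hc : c ∈ S)
    (hS : ∀ l ∈ S, l ᵥ* (M - Matrix.vecMulVec b k) ∈ S) {l : ι → K}
    (hl : l ᵥ* (M - Matrix.vecMulVec b k) - s • l ∈ S) : l ∈ S := by
  let f : (ι → K) →ₗ[K] ι → K := (M - Matrix.vecMulVec b k).vecMulLinear - s • LinearMap.id
  refine mem_of_map_mem (f := f) (fun l hl => S.sub_mem (hS l hl) (S.smul_mem s hl)) ?_ hl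
  by_contra hne
  obtain ⟨w, hw, hann⟩ := exists_ne_zero_forall_dotProduct_eq_zero hne
  refine hw (eq_zero_of_feedback_mulVec_eq_smul (k := k) hdet hs (dotProduct_eq _ _ fun l => ?_)
    (hann c (Submodule.mem_sup_right hc)))
  have hfl : (l ᵥ* (M - Matrix.vecMulVec b k) - s • l) ⬝ᵥ w = 0 :=
    hann _ (Submodule.mem_sup_left ⟨l, rfl⟩)
  rw [sub_dotProduct, smul_dotProduct, ← Matrix.dotProduct_mulVec, sub_eq_zero] at hfl
  rw [dotProduct_comm, hfl, smul_dotProduct, dotProduct_comm]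

end MinimumPhase

section Inversion

variable {ι : Type*} [Fintype ι] {M : Matrix ι ι ℂ} {b c : ι → ℂ} {z r : ℝ → ι → ℂ} {g : ℝ → ℂ}

/-- The functionals along which `z` tends to zero. They form a subspace, which allows the inverse
of a system to be studied without bringing it to a normal form. -/
def vanishingCovectors (z : ℝ → ι → ℂ) : Submodule ℂ (ι → ℂ) where
  carrier := {l | Tendsto (fun t => l ⬝ᵥ z t) atTop (𝓝 0)}
  zero_mem' := by simp only [Set.mem_ofPred_eq, zero_dotProduct, tendsto_const_nhds]
  add_mem' hl hl' := by simpa [add_dotProduct] using hl.add hl'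
  smul_mem' a l hl := by simpa [smul_dotProduct] using hl.const_mul a

theorem HasVelocity.tendsto_vecMul_dotProduct_add
    (h : HasVelocity z fun t => M *ᵥ z t + (g t • b + r t))
    (hz : UniformContinuousOn z (Set.Ici 0)) (hg : UniformContinuousOn g (Set.Ici 0))
    (hr : Tendsto r atTop (𝓝 0)) {l : ι → ℂ} (hl : l ∈ vanishingCovectors z) :
    Tendsto (fun t => (l ᵥ* M) ⬝ᵥ z t + g t * (l ⬝ᵥ b)) atTop (𝓝 0) := by
  refine HasVelocity.barbalat ((h.dotProduct l).congr_velocity fun t _ => ?_) hl ?_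
    (tendsto_dotProduct_zero hr l)
  · rw [dotProduct_add, dotProduct_add, dotProduct_smul, smul_eq_mul, Matrix.dotProduct_mulVec,
      add_assoc]
  · rw [uniformContinuousOn_iff_restrict] at hz hg ⊢
    exact ((dotProductBilin ℝ ℝ (l ᵥ* M)).toContinuousLinearMap.uniformContinuous.comp hz).add
      (((ContinuousLinearMap.mul ℝ ℂ).flip (l ⬝ᵥ b)).uniformContinuous.comp hg)

/- With `l₀ᵀ b = 1` and `l₀ᵀ z → 0`, Barbalat's lemma gives `g + l₀ᵀ M z → 0`. Eliminating `g` in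
this way makes `z` a solution of `ż = M₀ z + o(1)` with the zero dynamics
`M₀ = M - b l₀ᵀ M`. Its stable modes tend to zero, and its unstable modes are seen by the output. -/
theorem tendsto_zero_of_minimumPhase [DecidableEq ι] (hM : ∀ s ∈ spectrum ℂ M, s.re < 0)
    (hmp : ∀ s : ℂ, 0 ≤ s.re → c ⬝ᵥ ((s • 1 - M)⁻¹ *ᵥ b) ≠ 0)
    (h : HasVelocity z fun t => M *ᵥ z t + (g t • b + r t))
    (hz : UniformContinuousOn z (Set.Ici 0)) (hg : UniformContinuousOn g (Set.Ici 0))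
    (hr : Tendsto r atTop (𝓝 0)) (hc : c ∈ vanishingCovectors z) : Tendsto g atTop (𝓝 0) := by
  have hdet {s : ℂ} (hs : 0 ≤ s.re) : IsUnit (s • 1 - M).det := by
    rw [← Matrix.isUnit_iff_isUnit_det, ← Algebra.algebraMap_eq_smul_one]
    exact spectrum.notMem_iff.1 fun hmem => (hM s hmem).not_ge hs
  have hbarbalat {l : ι → ℂ} := h.tendsto_vecMul_dotProduct_add hz hg hr (l := l)
  obtain ⟨l₀, hl₀, hl₀b⟩ : ∃ l ∈ vanishingCovectors z, l ⬝ᵥ b = 1 := by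
    obtain ⟨l, hl, hlb⟩ := exists_dotProduct_ne_zero_of_transfer_ne_zero (hdet le_rfl)
      (hmp 0 le_rfl) hc fun l hl hlb => (hbarbalat hl).congr fun t => by
        rw [hlb, mul_zero, add_zero]
    exact ⟨(l ⬝ᵥ b)⁻¹ • l, Submodule.smul_mem _ _ hl, by
      rw [smul_dotProduct, smul_eq_mul, inv_mul_cancel₀ hlb]⟩
  have hg₀ : Tendsto (fun t => (l₀ ᵥ* M) ⬝ᵥ z t + g t) atTop (𝓝 0) := by
    simpa only [hl₀b, mul_one] using hbarbalat hl₀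
  let M₀ := M - Matrix.vecMulVec b (l₀ ᵥ* M)
  have hM₀ (l : ι → ℂ) (t : ℝ) :
      (l ᵥ* M₀) ⬝ᵥ z t = (l ᵥ* M) ⬝ᵥ z t - (l ⬝ᵥ b) * ((l₀ ᵥ* M) ⬝ᵥ z t) := by
    rw [Matrix.vecMul_sub, Matrix.vecMul_vecMulVec, sub_dotProduct, smul_dotProduct, smul_eq_mul]
  have hinv (l) (hl : l ∈ vanishingCovectors z) : l ᵥ* M₀ ∈ vanishingCovectors z := by
    have hlim := (hbarbalat hl).sub (hg₀.const_mul (l ⬝ᵥ b))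
    rw [mul_zero, sub_zero] at hlim
    exact hlim.congr fun t => by rw [hM₀]; ring
  have htop (l : ι → ℂ) : l ∈ vanishingCovectors z := by
    refine forall_covector_of_spectrum M₀ (Submodule.zero_mem _) (fun μ _ l hl => ?_) l
    rcases lt_or_ge μ.re 0 with hμ | hμ
    · have hlim := (hl.add (hg₀.const_mul (l ⬝ᵥ b))).add (tendsto_dotProduct_zero hr l)
      rw [mul_zero, add_zero, add_zero] at hlim
      refine ((h.dotProduct_linear μ l).congr_velocity fun t _ => ?_).tendsto_zero_of_linear hμ hlim
      simp only [sub_dotProduct, hM₀, dotProduct_add, dotProduct_smul, smul_eq_mul]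
      ring
    · exact mem_of_vecMul_feedback_sub_smul_mem (hdet hμ) (hmp μ hμ) hc hinv hl
  simpa using hg₀.sub (htop (l₀ ᵥ* M))

theorem IsMinimumPhase.input_tendsto_zero {n : ℕ} {F : Matrix (Fin n) (Fin n) ℝ}
    {b c : Fin n → ℝ} (hmp : IsMinimumPhase F b c) (hF : IsHurwitz F) {z r : ℝ → Fin n → ℝ}
    {g : ℝ → ℝ} (h : HasVelocity z fun t => F *ᵥ z t + (g t • b + r t))
    (hz : UniformContinuousOn z (Set.Ici 0)) (hg : UniformContinuousOn g (Set.Ici 0))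
    (hr : Tendsto r atTop (𝓝 0)) (hout : Tendsto (fun t => c ⬝ᵥ z t) atTop (𝓝 0)) :
    Tendsto g atTop (𝓝 0) := by
  have hcout : complexify c ∈ vanishingCovectors fun t => complexify (z t) := by
    change Tendsto (fun t => complexify c ⬝ᵥ complexify (z t)) atTop (𝓝 0)
    simp only [complexify_dotProduct_complexify]
    exact (Complex.continuous_ofReal.tendsto' 0 0 Complex.ofReal_zero).comp hout
  have hlim := tendsto_zero_of_minimumPhase (b := complexify b) (g := fun t => (g t : ℂ))
    (r := fun t => complexify (r t)) hF hmp (h.complexify.congr_velocity fun t _ => ?_)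
    (complexify.uniformContinuous.comp_uniformContinuousOn hz)
    (Complex.ofRealCLM.uniformContinuous.comp_uniformContinuousOn hg)
    ((complexify.continuous.tendsto' 0 0 (map_zero _)).comp hr) hcout
  · exact (Complex.continuous_re.tendsto 0).comp hlim
  · rw [map_add, map_smul, Complex.coe_smul]

end Inversion

/-! ### The adaptation law -/

section Switching

variable {m : ℕ} {θs : ℝ} {v : EuclideanSpace ℝ (Fin m)}

theorem switching_of_lt (hv : ‖v‖ < θs) : switching θs v = 0 := if_pos hv

theorem switching_of_two_mul_lt (hθs : 0 < θs) (hv : 2 * θs < ‖v‖) : switching θs v = 1 := by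
  rw [switching, if_neg (by linarith), if_neg hv.not_ge]

theorem switching_eq_max_min (hθs : 0 < θs) (v : EuclideanSpace ℝ (Fin m)) :
    switching θs v = max (min (‖v‖ / θs - 1) 1) 0 := by
  rw [switching]
  split_ifs with hlt hle
  · have := (div_lt_one hθs).2 hlt
    rw [max_eq_right (min_le_of_left_le (by linarith))]
  · have := (one_le_div hθs).2 (not_lt.1 hlt)
    have := (div_le_iff₀ hθs).2 hle
    rw [min_eq_left (by linarith), max_eq_left (by linarith)]
  · have := (lt_div_iff₀ hθs).2 (not_le.1 hle)
    rw [min_eq_right (by linarith), max_eq_left zero_le_one]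

theorem switching_nonneg (hθs : 0 < θs) (v : EuclideanSpace ℝ (Fin m)) : 0 ≤ switching θs v :=
  switching_eq_max_min hθs v ▸ le_max_right _ _

theorem switching_le_one (hθs : 0 < θs) (v : EuclideanSpace ℝ (Fin m)) : switching θs v ≤ 1 :=
  switching_eq_max_min hθs v ▸ max_le (min_le_right _ _) zero_le_one

theorem abs_switching_sub_le (hθs : 0 < θs) (v w : EuclideanSpace ℝ (Fin m)) :
    |switching θs v - switching θs w| ≤ ‖v - w‖ / θs := by
  rw [switching_eq_max_min hθs, switching_eq_max_min hθs]
  calc _ ≤ |min (‖v‖ / θs - 1) 1 - min (‖w‖ / θs - 1) 1| := abs_max_sub_max_le_abs _ _ _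
    _ ≤ |(‖v‖ / θs - 1) - (‖w‖ / θs - 1)| := by
      simpa using abs_min_sub_min_le_max (‖v‖ / θs - 1) 1 (‖w‖ / θs - 1) 1
    _ = |‖v‖ - ‖w‖| / θs := by
      rw [sub_sub_sub_cancel_right, ← sub_div, abs_div, abs_of_pos hθs]
    _ ≤ ‖v - w‖ / θs := by gcongr; exact abs_norm_sub_norm_le v w

theorem norm_switching_sub_smul_le (hθs : 0 < θs) {v w : EuclideanSpace ℝ (Fin m)}
    (hwv : ‖w‖ ≤ ‖v‖) : ‖(switching θs v - switching θs w) • w‖ ≤ 2 * ‖v - w‖ := by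
  rw [norm_smul, Real.norm_eq_abs]
  rcases lt_or_ge (2 * θs) ‖w‖ with hw | hw
  · rw [switching_of_two_mul_lt hθs hw, switching_of_two_mul_lt hθs (hw.trans_le hwv), sub_self,
      abs_zero, zero_mul]
    positivity
  · calc _ ≤ ‖v - w‖ / θs * (2 * θs) := by gcongr; exact abs_switching_sub_le hθs v w
      _ = 2 * ‖v - w‖ := by field_simp

theorem lipschitzWith_switching_smul (hθs : 0 < θs) :
    LipschitzWith 3 fun v : EuclideanSpace ℝ (Fin m) => switching θs v • v := by
  refine .of_dist_le_mul fun v w => ?_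
  rw [dist_eq_norm, dist_eq_norm, NNReal.coe_ofNat]
  wlog hwv : ‖w‖ ≤ ‖v‖ generalizing v w
  · rw [norm_sub_rev, norm_sub_rev v]
    exact this w v (not_le.1 hwv).le
  have hsplit : switching θs v • v - switching θs w • w
      = switching θs v • (v - w) + (switching θs v - switching θs w) • w := by module
  have hfst : ‖switching θs v • (v - w)‖ ≤ ‖v - w‖ := by
    rw [norm_smul, Real.norm_of_nonneg (switching_nonneg hθs v)]
    exact mul_le_of_le_one_left (norm_nonneg _) (switching_le_one hθs v)
  rw [hsplit]
  linarith [norm_add_le_of_le hfst (norm_switching_sub_smul_le hθs hwv)]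

end Switching

section Adaptation

variable {m : ℕ} {γ θs : ℝ} {θ : EuclideanSpace ℝ (Fin m)}

/-- The right-hand side of the adaptation law at the estimate `θh`, when the augmented error is
`ωᵀ (θ - θh) + δ` for the filtered regressor `ω` and a disturbance `δ`. -/
noncomputable def gradientLaw (γ θs : ℝ) (θ ω : EuclideanSpace ℝ (Fin m)) (δ : ℝ)
    (θh : EuclideanSpace ℝ (Fin m)) : EuclideanSpace ℝ (Fin m) :=
  (γ * (inner ℝ ω (θ - θh) + δ)) • ω - switching θs θh • θh

/-- `θh` is a solution of the adaptation law for the regressor `ω`, the true parameter `θ` and the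
disturbance `δ`. The split of the augmented error into `ωᵀ (θ - θh)` and `δ` is not unique; the
choice `θ = 0` is of use when a bound on `θh` is sought before one on the error coordinates. -/
def IsGradientEstimate (γ θs : ℝ) (θ : EuclideanSpace ℝ (Fin m))
    (ω : ℝ → EuclideanSpace ℝ (Fin m)) (δ : ℝ → ℝ) (θh : ℝ → EuclideanSpace ℝ (Fin m)) : Prop :=
  HasVelocity θh fun t => gradientLaw γ θs θ (ω t) (δ t) (θh t)

/-- The decay rate of `|θ - θh|²` along the undisturbed adaptation law when `|θ| < θs`. -/
noncomputable def dissipation (γ θs : ℝ) (θ ω θh : EuclideanSpace ℝ (Fin m)) : ℝ :=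
  γ * inner ℝ ω (θ - θh) ^ 2 + 2 * (θs - ‖θ‖) * ‖switching θs θh • θh‖

theorem neg_two_mul_inner_gradientLaw_le_of_large (hγ : 0 ≤ γ) (hθs : 0 < θs)
    (ω : EuclideanSpace ℝ (Fin m)) (δ : ℝ) {θh : EuclideanSpace ℝ (Fin m)}
    (hlarge : ‖θ‖ + 2 * θs < ‖θ - θh‖) :
    -2 * inner ℝ (θ - θh) (gradientLaw γ θs θ ω δ θh)
      ≤ γ * (δ ^ 2 / 2) + ‖θ‖ ^ 2 - ‖θ - θh‖ ^ 2 := by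
  have hpolar : ‖θ‖ ^ 2 = ‖θ - θh‖ ^ 2 + 2 * inner ℝ (θ - θh) θh + ‖θh‖ ^ 2 := by
    rw [← norm_add_sq_real, sub_add_cancel]
  rw [gradientLaw, switching_of_two_mul_lt hθs (by linarith [norm_sub_le θ θh]), one_smul,
    inner_sub_right, inner_smul_right, real_inner_comm ω (θ - θh)]
  set q := inner ℝ ω (θ - θh)
  nlinarith [mul_nonneg hγ (sq_nonneg (2 * q + δ)), sq_nonneg ‖θh‖]

theorem inner_switching_smul_le (hθs : 0 < θs) (θ θh : EuclideanSpace ℝ (Fin m)) :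
    inner ℝ (θ - θh) (switching θs θh • θh) ≤ -((θs - ‖θ‖) * ‖switching θs θh • θh‖) := by
  rw [norm_smul, Real.norm_of_nonneg (switching_nonneg hθs θh), inner_smul_right]
  rcases lt_or_ge ‖θh‖ θs with hlt | hge
  · simp [switching_of_lt hlt]
  · have hinner : inner ℝ (θ - θh) θh ≤ -((θs - ‖θ‖) * ‖θh‖) := by
      rw [inner_sub_left, real_inner_self_eq_norm_sq]
      nlinarith [real_inner_le_norm θ θh, norm_nonneg θh]
    linarith [mul_le_mul_of_nonneg_left hinner (switching_nonneg hθs θh)]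

theorem neg_two_mul_inner_gradientLaw_le (hγ : 0 ≤ γ) (hθs : 0 < θs)
    (ω : EuclideanSpace ℝ (Fin m)) (δ : ℝ) (θh : EuclideanSpace ℝ (Fin m)) :
    -2 * inner ℝ (θ - θh) (gradientLaw γ θs θ ω δ θh)
      ≤ -dissipation γ θs θ ω θh + γ * δ ^ 2 := by
  have hswitch := inner_switching_smul_le hθs θ θh
  rw [gradientLaw, dissipation, inner_sub_right, inner_smul_right, real_inner_comm ω (θ - θh)]
  set q := inner ℝ ω (θ - θh)
  nlinarith [mul_nonneg hγ (sq_nonneg (q + δ))]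



theorem dissipation_nonneg (hγ : 0 ≤ γ) (hθ : ‖θ‖ ≤ θs) (ω θh : EuclideanSpace ℝ (Fin m)) :
    0 ≤ dissipation γ θs θ ω θh := by
  have := sub_nonneg.2 hθ
  unfold dissipation
  positivity

theorem continuous_gradientLaw (hθs : 0 < θs) :
    Continuous fun p : (EuclideanSpace ℝ (Fin m) × ℝ) × EuclideanSpace ℝ (Fin m) =>
      gradientLaw γ θs θ p.1.1 p.1.2 p.2 := by
  have hswitch := (lipschitzWith_switching_smul (m := m) hθs).continuous
  have hleak := hswitch.comp
    (continuous_snd (X := EuclideanSpace ℝ (Fin m) × ℝ) (Y := EuclideanSpace ℝ (Fin m)))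
  exact Continuous.sub (by fun_prop) hleak

theorem continuous_dissipation (hθs : 0 < θs) :
    Continuous fun p : EuclideanSpace ℝ (Fin m) × EuclideanSpace ℝ (Fin m) =>
      dissipation γ θs θ p.1 p.2 := by
  have hleak := (lipschitzWith_switching_smul (m := m) hθs).continuous.comp
    (continuous_snd (X := EuclideanSpace ℝ (Fin m)) (Y := EuclideanSpace ℝ (Fin m)))
  exact Continuous.add (by fun_prop) (continuous_const.mul hleak.norm)

theorem lipschitzWith_gradientLaw (hθs : 0 < θs) (ω : EuclideanSpace ℝ (Fin m)) (δ : ℝ) :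
    LipschitzWith (‖γ‖₊ * ‖ω‖₊ ^ 2 + 3) (gradientLaw γ θs θ ω δ) := by
  refine LipschitzWith.sub (.of_dist_le_mul fun v w => ?_) (lipschitzWith_switching_smul hθs)
  have hdiff : (γ * (inner ℝ ω (θ - v) + δ)) • ω - (γ * (inner ℝ ω (θ - w) + δ)) • ω
      = (γ * inner ℝ ω (w - v)) • ω := by
    rw [← sub_smul, ← mul_sub, add_sub_add_right_eq_sub, ← inner_sub_right, sub_sub_sub_cancel_left]
  rw [dist_eq_norm, hdiff, norm_smul, norm_mul, dist_comm, dist_eq_norm]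
  push_cast
  calc ‖γ‖ * ‖inner ℝ ω (w - v)‖ * ‖ω‖ ≤ ‖γ‖ * (‖ω‖ * ‖w - v‖) * ‖ω‖ := by
        gcongr; exact norm_inner_le_norm _ _
    _ = ‖γ‖ * ‖ω‖ ^ 2 * ‖w - v‖ := by ring

variable {ω θh : ℝ → EuclideanSpace ℝ (Fin m)} {δ : ℝ → ℝ}

theorem boundedSignal_gradientLaw (hθs : 0 < θs) (hω : BoundedSignal ω) (hδ : BoundedSignal δ)
    (hθh : BoundedSignal θh) :
    BoundedSignal fun t => gradientLaw γ θs θ (ω t) (δ t) (θh t) :=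
  (((hω.prodMk hδ).prodMk hθh).continuous_comp (continuous_gradientLaw hθs) :)

theorem exists_isGradientEstimate (γ : ℝ) (hθs : 0 < θs) (θ : EuclideanSpace ℝ (Fin m))
    (hω : IsAdmissible ω) (hδ : IsAdmissible δ) (θh₀ : EuclideanSpace ℝ (Fin m)) :
    ∃ θh, IsGradientEstimate γ θs θ ω δ θh ∧ θh 0 = θh₀ := by
  obtain ⟨C, hC⟩ := boundedSignal_gradientLaw (γ := γ) (θ := θ) hθs hω.2 hδ.2 (.const 0)
  obtain ⟨B, hB⟩ := hω.boundedSignal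
  have hG : IsCaratheodoryField (fun t => gradientLaw γ θs θ (ω t) (δ t))
      (‖γ‖₊ * ‖B‖₊ ^ 2 + 3) C :=
    { aestronglyMeasurable := fun z hz => by
        have hp := (hω.1.prodMk hδ.1).prodMk hz.aestronglyMeasurable
        exact ((continuous_gradientLaw hθs).comp_aestronglyMeasurable hp :)
      lipschitzWith := fun t ht => (lipschitzWith_gradientLaw hθs (ω t) (δ t)).weaken <| by
        gcongr
        exact (hB t ht).trans (le_abs_self B)
      norm_zero_le := hC }
  exact hG.exists_hasVelocity θh₀

namespace IsGradientEstimate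

theorem hasVelocity_sub (h : IsGradientEstimate γ θs θ ω δ θh) :
    HasVelocity (fun t => θ - θh t) fun t => -gradientLaw γ θs θ (ω t) (δ t) (θh t) := by
  simpa only [zero_sub] using (HasVelocity.const θ).sub h

theorem hasVelocity_norm_sq (h : IsGradientEstimate γ θs θ ω δ θh) :
    HasVelocity (fun t => ‖θ - θh t‖ ^ 2)
      fun t => -2 * inner ℝ (θ - θh t) (gradientLaw γ θs θ (ω t) (δ t) (θh t)) := by
  simpa only [inner_neg_right, mul_neg, neg_mul] using h.hasVelocity_sub.norm_sq

theorem boundedSignal (hγ : 0 ≤ γ) (hθs : 0 < θs) (h : IsGradientEstimate γ θs θ ω δ θh)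
    (hδ : BoundedSignal δ) : BoundedSignal θh := by
  obtain ⟨D, hD⟩ := hδ
  let M := max (max ((‖θ‖ + 2 * θs) ^ 2) (γ * D ^ 2 + ‖θ‖ ^ 2)) (‖θ - θh 0‖ ^ 2)
  have hV (t : ℝ) (ht : 0 ≤ t) : ‖θ - θh t‖ ^ 2 ≤ M := by
    refine h.hasVelocity_norm_sq.le_of_velocity_nonpos le_rfl (.of_forall fun s hs hlt => ?_)
      (le_max_right _ _) t ht
    simp only [max_lt_iff] at hlt
    obtain ⟨⟨hlarge, hnoise⟩, -⟩ := hlt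
    have hrate := neg_two_mul_inner_gradientLaw_le_of_large hγ hθs (ω s) (δ s)
      (lt_of_pow_lt_pow_left₀ 2 (norm_nonneg _) hlarge)
    have hδD : δ s ^ 2 ≤ D ^ 2 := sq_le_sq' (abs_le.1 (hD s hs)).1 (abs_le.1 (hD s hs)).2
    nlinarith [mul_le_mul_of_nonneg_left hδD hγ, mul_nonneg hγ (sq_nonneg (δ s))]
  refine ⟨‖θ‖ + √M, fun t ht => ?_⟩
  have htri := norm_sub_le θ (θ - θh t)
  rw [sub_sub_cancel] at htri
  exact htri.trans (add_le_add_right (Real.le_sqrt_of_sq_le (hV t ht)) _)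

end IsGradientEstimate

theorem ae_abs_le_supNorm {d : ℝ → ℝ} (hd : BoundedSignal d) :
    ∀ᵐ t, 0 ≤ t → |d t| ≤ supNorm d := by
  obtain ⟨C, hC⟩ := hd
  have hfin : eLpNormEssSup d (volume.restrict (Set.Ici (0 : ℝ))) < ⊤ :=
    eLpNormEssSup_lt_top_of_ae_bound ((ae_restrict_iff' measurableSet_Ici).2 (.of_forall hC))
  filter_upwards [(ae_restrict_iff' measurableSet_Ici).1
    (ae_le_eLpNormEssSup (f := d) (μ := volume.restrict (Set.Ici (0 : ℝ))))] with t ht h0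
  simpa [supNorm, eLpNorm_exponent_top] using ENNReal.toReal_mono hfin.ne (ht h0)

theorem tendsto_infDist_closedBall {E : Type*} [NormedAddCommGroup E] [NormedSpace ℝ E]
    {v : ℝ → E} {R : ℝ} (hR : 0 ≤ R) (h : ∀ η > 0, ∀ᶠ t in atTop, ‖v t‖ ^ 2 ≤ R ^ 2 + η) :
    Tendsto (fun t => Metric.infDist (v t) (Metric.closedBall 0 R)) atTop (𝓝 0) := by
  refine Metric.nhds_basis_closedBall.tendsto_right_iff.2 fun ε hε => ?_
  filter_upwards [h (ε ^ 2) (by positivity)] with t ht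
  have hmem : v t ∈ Metric.cthickening ε (Metric.closedBall 0 R) := by
    rw [cthickening_closedBall hε.le hR, mem_closedBall_zero_iff]
    exact le_of_sq_le_sq (by nlinarith [mul_nonneg hε.le hR]) (by positivity)
  rw [mem_closedBall_zero_iff, Real.norm_of_nonneg Metric.infDist_nonneg]
  exact ENNReal.toReal_le_of_le_ofReal hε.le (Metric.mem_cthickening_iff.1 hmem)

namespace IsGradientEstimate

variable {d e : ℝ → ℝ}

theorem eventually_norm_sub_sq_le (hγ : 0 ≤ γ) (hθs : 0 < θs)
    (h : IsGradientEstimate γ θs θ ω (fun t => d t + e t) θh) (hd : BoundedSignal d)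
    (he : Tendsto e atTop (𝓝 0)) {η : ℝ} (hη : 0 < η) :
    ∀ᶠ t in atTop,
      ‖θ - θh t‖ ^ 2 ≤ max ((‖θ‖ + 2 * θs) ^ 2) (γ * supNorm d ^ 2 + ‖θ‖ ^ 2) + η := by
  have he' : Tendsto (fun t => γ * e t ^ 2) atTop (𝓝 0) := by
    simpa using (he.pow 2).const_mul γ
  obtain ⟨N, hN⟩ := eventually_atTop.1 (he'.eventually (Iio_mem_nhds (half_pos hη)))
  refine h.hasVelocity_norm_sq.eventually_le_of_velocity_le (le_max_right N 0) (half_pos hη)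
    (fun t => by positivity) ?_
  filter_upwards [ae_abs_le_supNorm hd] with t htd ht hlt
  obtain ⟨hNt, ht0⟩ := max_le_iff.1 ht
  rw [← max_add_add_right, max_lt_iff] at hlt
  have hrate := neg_two_mul_inner_gradientLaw_le_of_large hγ hθs (ω t) (d t + e t)
    (lt_of_pow_lt_pow_left₀ 2 (norm_nonneg _) ((le_add_of_nonneg_right hη.le).trans_lt hlt.1))
  have hdt : d t ^ 2 ≤ supNorm d ^ 2 := sq_le_sq' (abs_le.1 (htd ht0)).1 (abs_le.1 (htd ht0)).2
  have het : γ * e t ^ 2 < η / 2 := hN t hNt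
  have hδ : (d t + e t) ^ 2 / 2 ≤ supNorm d ^ 2 + e t ^ 2 := by nlinarith [sq_nonneg (d t - e t)]
  linarith [mul_le_mul_of_nonneg_left hδ hγ]

theorem tendsto_infDist_residualSet (hγ : 0 ≤ γ) (hθs : 0 < θs)
    (h : IsGradientEstimate γ θs θ ω (fun t => d t + e t) θh) (hd : BoundedSignal d)
    (he : Tendsto e atTop (𝓝 0)) :
    Tendsto (fun t => Metric.infDist (θ - θh t) (residualSet γ θs θ d)) atTop (𝓝 0) := by
  let R := max ((‖θ‖ + 2 * θs) ^ 2) (γ * supNorm d ^ 2 + ‖θ‖ ^ 2)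
  have hR : 0 ≤ R := (sq_nonneg _).trans (le_max_left _ _)
  have hset : residualSet γ θs θ d = Metric.closedBall 0 √R := by
    ext v
    rw [mem_closedBall_zero_iff, Real.le_sqrt (norm_nonneg v) hR]
    rfl
  rw [hset]
  refine tendsto_infDist_closedBall (Real.sqrt_nonneg R) fun η hη => ?_
  rw [Real.sq_sqrt hR]
  exact h.eventually_norm_sub_sq_le hγ hθs hd he hη

theorem uniformContinuousOn (hγ : 0 ≤ γ) (hθs : 0 < θs) (h : IsGradientEstimate γ θs θ ω δ θh)
    (hω : BoundedSignal ω) (hδ : BoundedSignal δ) : UniformContinuousOn θh (Set.Ici 0) :=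
  HasVelocity.uniformContinuousOn h <|
    boundedSignal_gradientLaw hθs hω hδ (h.boundedSignal hγ hθs hδ)

/- The exponentially decaying disturbance is absorbed by adding `γ C² exp (-2 a t) / (2 a)` to
`|θ - θh|²`. -/
theorem tendsto_dissipation (hγ : 0 ≤ γ) (hθs : 0 < θs) (hθ : ‖θ‖ ≤ θs)
    (h : IsGradientEstimate γ θs θ ω δ θh) (hω : BoundedSignal ω)
    (hω' : UniformContinuousOn ω (Set.Ici 0)) {a C : ℝ} (ha : 0 < a)
    (hδ : ∀ t, 0 ≤ t → |δ t| ≤ C * Real.exp (-a * t)) :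
    Tendsto (fun t => dissipation γ θs θ (ω t) (θh t)) atTop (𝓝 0) := by
  have hC : 0 ≤ C := by simpa using (abs_nonneg _).trans (hδ 0 le_rfl)
  have hδb : BoundedSignal δ := ⟨C, fun t ht => (hδ t ht).trans <|
    mul_le_of_le_one_right hC (Real.exp_le_one_iff.2 (by nlinarith))⟩
  have hU : HasVelocity (fun t => γ * C ^ 2 / (2 * a) * Real.exp (-(2 * a) * t))
      fun t => -(γ * C ^ 2 * Real.exp (-(2 * a) * t)) := by
    refine .of_hasDerivAt (fun t => ?_) (by fun_prop)
    refine (((hasDerivAt_id' t).const_mul (-(2 * a))).exp.const_mul _).congr_deriv ?_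
    field_simp
  have hUC : UniformContinuousOn (fun t => dissipation γ θs θ (ω t) (θh t)) (Set.Ici 0) := by
    have hz := hω.prodMk (h.boundedSignal hγ hθs hδb)
    have hz' := uniformContinuousOn_prodMk hω' (h.uniformContinuousOn hγ hθs hω hδb)
    exact (hz.uniformContinuousOn_comp (continuous_dissipation hθs) hz' :)
  refine (h.hasVelocity_norm_sq.add hU).tendsto_zero_of_velocity_le_neg
    (fun t _ => by positivity) hUC (fun t _ => dissipation_nonneg hγ hθ _ _) fun t ht => ?_
  have hsq : δ t ^ 2 ≤ C ^ 2 * Real.exp (-(2 * a) * t) := by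
    rw [← sq_abs]
    calc |δ t| ^ 2 ≤ (C * Real.exp (-a * t)) ^ 2 := by gcongr; exact hδ t ht
      _ = C ^ 2 * Real.exp (-(2 * a) * t) := by
        rw [mul_pow, ← Real.exp_nat_mul]; ring_nf
  linarith [neg_two_mul_inner_gradientLaw_le hγ hθs (θ := θ) (ω t) (δ t) (θh t),
    mul_le_mul_of_nonneg_left hsq hγ]

end IsGradientEstimate

theorem tendsto_inner_of_tendsto_dissipation (hγ : 0 < γ) (hθ : ‖θ‖ ≤ θs)
    (h : Tendsto (fun t => dissipation γ θs θ (ω t) (θh t)) atTop (𝓝 0)) :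
    Tendsto (fun t => inner ℝ (ω t) (θ - θh t)) atTop (𝓝 0) := by
  have hsq : Tendsto (fun t => inner ℝ (ω t) (θ - θh t) ^ 2) atTop (𝓝 0) := by
    refine squeeze_zero (fun t => sq_nonneg _) (fun t => ?_)
      (by simpa only [zero_div] using h.div_const γ)
    rw [le_div_iff₀' hγ]
    exact le_add_of_nonneg_right (mul_nonneg (by linarith) (norm_nonneg _))
  exact (tendsto_zero_iff_abs_tendsto_zero _).2
    (by simpa [Function.comp_def, Real.sqrt_sq_eq_abs] using hsq.sqrt)

theorem tendsto_switching_smul_of_tendsto_dissipation (hγ : 0 ≤ γ) (hθ : ‖θ‖ < θs)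
    (h : Tendsto (fun t => dissipation γ θs θ (ω t) (θh t)) atTop (𝓝 0)) :
    Tendsto (fun t => switching θs (θh t) • θh t) atTop (𝓝 0) := by
  have hgap : 0 < 2 * (θs - ‖θ‖) := by linarith
  refine squeeze_zero_norm (fun t => ?_)
    (by simpa only [zero_div] using h.div_const (2 * (θs - ‖θ‖)))
  rw [le_div_iff₀' hgap]
  exact le_add_of_nonneg_left (mul_nonneg hγ (sq_nonneg _))

theorem tendsto_gradientLaw_of_tendsto_dissipation (hγ : 0 < γ) (hθ : ‖θ‖ < θs)
    (hω : BoundedSignal ω) (hδ : Tendsto δ atTop (𝓝 0))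
    (h : Tendsto (fun t => dissipation γ θs θ (ω t) (θh t)) atTop (𝓝 0)) :
    Tendsto (fun t => gradientLaw γ θs θ (ω t) (δ t) (θh t)) atTop (𝓝 0) := by
  have herr := ((tendsto_inner_of_tendsto_dissipation hγ hθ.le h).add hδ).const_mul γ
  rw [add_zero, mul_zero] at herr
  simpa only [sub_zero, gradientLaw] using (herr.zero_smul_isBoundedUnder_le hω.isBoundedUnder).sub
    (tendsto_switching_smul_of_tendsto_dissipation hγ.le hθ h)

end Adaptation

/-! ### Persistent excitation -/

section PersistentExcitation

variable {m : ℕ} {f : ℝ → EuclideanSpace ℝ (Fin m)}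

theorem dotProduct_integral_mulVec {a b : ℝ}
    (hf : ∀ i j, IntervalIntegrable (fun s => f s i * f s j) volume a b)
    (v : EuclideanSpace ℝ (Fin m)) :
    v.ofLp ⬝ᵥ ((Matrix.of fun i j : Fin m => ∫ s in a..b, f s i * f s j) *ᵥ v.ofLp)
      = ∫ s in a..b, inner ℝ (f s) v ^ 2 := by
  have hsq (s : ℝ) : inner ℝ (f s) v ^ 2 = ∑ i, ∑ j, v i * (f s i * f s j * v j) := by
    rw [PiLp.inner_apply, sq, Finset.sum_mul_sum]
    refine Finset.sum_congr rfl fun i _ => Finset.sum_congr rfl fun j _ => ?_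
    simp only [RCLike.inner_apply, conj_trivial]
    ring
  have hint (i j : Fin m) :
      IntervalIntegrable (fun s => v i * (f s i * f s j * v j)) volume a b :=
    ((hf i j).mul_const (v j)).const_mul (v i)
  have hint' (i : Fin m) :
      IntervalIntegrable (fun s => ∑ j, v i * (f s i * f s j * v j)) volume a b := by
    simpa only [Finset.sum_fn] using IntervalIntegrable.sum Finset.univ fun j _ => hint i j
  simp only [hsq]
  rw [intervalIntegral.integral_finsetSum fun i _ => hint' i]
  simp only [intervalIntegral.integral_finsetSum fun j _ => hint _ j,
    intervalIntegral.integral_const_mul, intervalIntegral.integral_mul_const, dotProduct,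
    Matrix.mulVec, Matrix.of_apply, Finset.mul_sum]

namespace PersistentlyExciting

theorem intervalIntegrable_mul (hf : PersistentlyExciting f) (i j : Fin m) {s t : ℝ}
    (hs : 0 ≤ s) (ht : 0 ≤ t) : IntervalIntegrable (fun r => f r i * f r j) volume s t := by
  obtain ⟨hmeas, ⟨C, hC⟩, -⟩ := hf
  have hm : AEMeasurable f (volume.restrict (Set.Ici 0)) :=
    (aemeasurable_restrict_iff_comap_subtype measurableSet_Ici).2 hmeas.aemeasurable
  have hmi (i : Fin m) : AEStronglyMeasurable (fun s => f s i) (volume.restrict (Set.Ici 0)) :=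
    (EuclideanSpace.proj i : EuclideanSpace ℝ (Fin m) →L[ℝ] ℝ).continuous.comp_aestronglyMeasurable
      hm.aestronglyMeasurable
  have hIoc : Set.uIoc s t ⊆ Set.Ici 0 := fun r hr => (le_min hs ht).trans hr.1.le
  refine (intervalIntegrable_const (c := C * C)).mono_fun
    (((hmi i).mul (hmi j)).mono_measure (Measure.restrict_mono hIoc le_rfl))
    ((ae_restrict_iff' measurableSet_uIoc).2 (.of_forall fun r hr => ?_))
  have hfr (i : Fin m) : ‖f r i‖ ≤ ‖C‖ :=
    ((PiLp.norm_apply_le _ i).trans (hC r (hIoc hr))).trans (Real.le_norm_self C)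
  simp only [norm_mul]
  exact mul_le_mul (hfr i) (hfr j) (norm_nonneg _) (norm_nonneg _)

theorem exists_le_integral (hf : PersistentlyExciting f) :
    ∃ α T : ℝ, 0 < α ∧ 0 < T ∧ ∀ t, 0 ≤ t → ∀ v : EuclideanSpace ℝ (Fin m),
      α * ‖v‖ ^ 2 ≤ ∫ s in t..(t + T), inner ℝ (f s) v ^ 2 := by
  obtain ⟨-, -, α, T, hα, hT, hpsd⟩ := id hf
  refine ⟨α, T, hα, hT, fun t ht v => ?_⟩
  have hquad := (hpsd t ht).dotProduct_mulVec_nonneg v.ofLp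
  have hnorm : v.ofLp ⬝ᵥ v.ofLp = ‖v‖ ^ 2 := by
    rw [EuclideanSpace.real_norm_sq_eq]
    simp only [dotProduct, sq]
  rw [star_trivial, Matrix.sub_mulVec, dotProduct_sub, Matrix.smul_mulVec, Matrix.one_mulVec,
    dotProduct_smul, smul_eq_mul, sub_nonneg, hnorm, dotProduct_integral_mulVec fun i j =>
      hf.intervalIntegrable_mul i j ht (add_nonneg ht hT.le)] at hquad
  exact hquad

end PersistentlyExciting

theorem norm_sq_le_of_le_integral {ϑ ν : ℝ → EuclideanSpace ℝ (Fin m)} {α T C η t : ℝ}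
    (hT : 0 ≤ T) (ht : 0 ≤ t) (hϑ : HasVelocity ϑ ν)
    (hα : α * ‖ϑ t‖ ^ 2 ≤ ∫ s in t..(t + T), inner ℝ (f s) (ϑ t) ^ 2)
    (hC : ∀ s, t ≤ s → ‖f s‖ ≤ C) (hν : ∀ s, t ≤ s → ‖ν s‖ ≤ η)
    (hfϑ : ∀ s, t ≤ s → |inner ℝ (f s) (ϑ s)| ≤ η) :
    α * ‖ϑ t‖ ^ 2 ≤ (η * (1 + C * T)) ^ 2 * T := by
  have hη : 0 ≤ η := (norm_nonneg _).trans (hν t le_rfl)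
  have hC0 : 0 ≤ C := (norm_nonneg _).trans (hC t le_rfl)
  have hfrozen : ∀ s ∈ Set.uIoc t (t + T), |inner ℝ (f s) (ϑ t)| ≤ η * (1 + C * T) := by
    intro s hs
    rw [Set.uIoc_of_le (by linarith)] at hs
    have hdrift : ‖ϑ s - ϑ t‖ ≤ η * T :=
      calc ‖ϑ s - ϑ t‖ ≤ η * (s - t) := by
            simpa using hϑ.norm_sub_sub_smul_le (a := 0) ht hs.1.le fun r hr _ => by
              simpa using hν r hr
        _ ≤ η * T := by gcongr; linarith [hs.2]
    calc |inner ℝ (f s) (ϑ t)|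
        = |inner ℝ (f s) (ϑ s) - inner ℝ (f s) (ϑ s - ϑ t)| := by
          rw [← inner_sub_right, sub_sub_cancel]
      _ ≤ η + C * (η * T) := (abs_sub _ _).trans <| add_le_add (hfϑ s hs.1.le) <|
          (abs_real_inner_le_norm _ _).trans <|
            mul_le_mul (hC s hs.1.le) hdrift (norm_nonneg _) hC0
      _ = η * (1 + C * T) := by ring
  have hint := intervalIntegral.norm_integral_le_of_norm_le_const
    (f := fun s => inner ℝ (f s) (ϑ t) ^ 2) fun s hs => by
      rw [norm_pow]; exact pow_le_pow_left₀ (norm_nonneg _) (hfrozen s hs) 2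
  rw [add_sub_cancel_left, abs_of_nonneg hT] at hint
  exact hα.trans ((Real.le_norm_self _).trans hint)

theorem PersistentlyExciting.tendsto_zero {ϑ ν : ℝ → EuclideanSpace ℝ (Fin m)}
    (hf : PersistentlyExciting f) (hϑ : HasVelocity ϑ ν) (hν : Tendsto ν atTop (𝓝 0))
    (hfϑ : Tendsto (fun t => inner ℝ (f t) (ϑ t)) atTop (𝓝 0)) : Tendsto ϑ atTop (𝓝 0) := by
  obtain ⟨α, T, hα, hT, hPE⟩ := hf.exists_le_integral
  obtain ⟨C, hC⟩ := hf.2.1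
  refine Metric.nhds_basis_closedBall.tendsto_right_iff.2 fun ε hε => ?_
  have hlim : Tendsto (fun η => (η * (1 + C * T)) ^ 2 * T) (𝓝[>] 0) (𝓝 0) :=
    tendsto_nhdsWithin_of_tendsto_nhds (Continuous.tendsto' (by fun_prop) _ _ (by simp))
  obtain ⟨η, hηε, hη⟩ := ((hlim.eventually (Iio_mem_nhds (show 0 < α * ε ^ 2 by positivity))).and
    self_mem_nhdsWithin).exists
  have hsmall := (Metric.nhds_basis_closedBall.tendsto_right_iff.1 hν η hη).and
    (Metric.nhds_basis_closedBall.tendsto_right_iff.1 hfϑ η hη)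
  filter_upwards [eventually_ge_atTop 0, eventually_forall_ge_atTop.2 hsmall] with t ht hs
  have hsq := norm_sq_le_of_le_integral hT.le ht hϑ (hPE t ht (ϑ t))
    (fun s hts => hC s (ht.trans hts)) (fun s hts => mem_closedBall_zero_iff.1 (hs s hts).1)
    (fun s hts => mem_closedBall_zero_iff.1 (hs s hts).2)
  rw [mem_closedBall_zero_iff]
  exact le_of_sq_le_sq (le_of_mul_le_mul_left (hsq.trans (Set.mem_Iio.1 hηε).le) hα) hε.le

end PersistentExcitation

/-! ### The swapping identity -/

section Swapping

variable {n m : ℕ} {F : Matrix (Fin n) (Fin n) ℝ} {b : Fin n → ℝ}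
  {f ϑ ν : ℝ → EuclideanSpace ℝ (Fin m)} {Ω : Fin m → ℝ → Fin n → ℝ}

theorem HasVelocity.sub_linear {z z' w w' : ℝ → Fin n → ℝ}
    (h : HasVelocity z fun t => F *ᵥ z t + w t) (h' : HasVelocity z' fun t => F *ᵥ z' t + w' t) :
    HasVelocity (fun t => z t - z' t) fun t => F *ᵥ (z t - z' t) + (w t - w' t) :=
  (h.sub h').congr_velocity fun t _ => by rw [Matrix.mulVec_sub]; abel

/-- The combination `∑ᵢ ϑᵢ Ωᵢ` of regressor filter states with time-varying coefficients. It is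
compared with the state of a single filter driven by `f ᵀ ϑ`, from which it differs only through
the velocity of `ϑ`. -/
def filterCombination (Ω : Fin m → ℝ → Fin n → ℝ) (ϑ : ℝ → EuclideanSpace ℝ (Fin m)) (t : ℝ) :
    Fin n → ℝ :=
  ∑ i, ϑ t i • Ω i t

theorem hasVelocity_filterCombination
    (hΩ : ∀ i, IsFilterState F b (fun t => f t i) (Ω i)) (hϑ : HasVelocity ϑ ν) :
    HasVelocity (filterCombination Ω ϑ) fun t =>
      F *ᵥ filterCombination Ω ϑ t + (inner ℝ (f t) (ϑ t) • b + filterCombination Ω ν t) := by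
  have hsum := HasVelocity.sum (s := Finset.univ) fun i _ =>
    (hϑ.map_clm (EuclideanSpace.proj i : EuclideanSpace ℝ (Fin m) →L[ℝ] ℝ)).smul (hΩ i)
  refine hsum.congr_velocity fun t _ => ?_
  simp only [filterCombination, PiLp.inner_apply, RCLike.inner_apply, conj_trivial,
    Finset.sum_smul, Matrix.mulVec_sum, Matrix.mulVec_smul, ← Finset.sum_add_distrib]
  refine Finset.sum_congr rfl fun i _ => ?_
  simp only [PiLp.proj_apply]
  module

theorem continuous_filterCombination :
    Continuous fun p : (Fin m → Fin n → ℝ) × EuclideanSpace ℝ (Fin m) => ∑ i, p.2 i • p.1 i := by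
  fun_prop

theorem boundedSignal_filterCombination (hΩ : ∀ i, BoundedSignal (Ω i)) (hϑ : BoundedSignal ϑ) :
    BoundedSignal (filterCombination Ω ϑ) :=
  (((BoundedSignal.pi hΩ).prodMk hϑ).continuous_comp continuous_filterCombination :)

theorem tendsto_filterCombination (hΩ : ∀ i, BoundedSignal (Ω i))
    (hϑ : Tendsto ϑ atTop (𝓝 0)) : Tendsto (filterCombination Ω ϑ) atTop (𝓝 0) := by
  have hterm (i : Fin m) : Tendsto (fun t => ϑ t i • Ω i t) atTop (𝓝 0) :=
    (((EuclideanSpace.proj i : EuclideanSpace ℝ (Fin m) →L[ℝ] ℝ).continuous.tendsto' 0 0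
      (map_zero _)).comp hϑ).zero_smul_isBoundedUnder_le (hΩ i).isBoundedUnder
  unfold filterCombination
  simpa only [Finset.sum_const_zero] using tendsto_finsetSum Finset.univ fun i _ => hterm i

theorem IsHurwitz.tendsto_sub_filterCombination (hF : IsHurwitz F) {ζ : ℝ → Fin n → ℝ}
    (hζ : IsFilterState F b (fun t => inner ℝ (f t) (ϑ t)) ζ)
    (hΩ : ∀ i, IsFilterState F b (fun t => f t i) (Ω i)) (hΩb : ∀ i, BoundedSignal (Ω i))
    (hϑ : HasVelocity ϑ ν) (hν : Tendsto ν atTop (𝓝 0)) :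
    Tendsto (fun t => ζ t - filterCombination Ω ϑ t) atTop (𝓝 0) := by
  refine hF.tendsto_zero (HasVelocity.sub_linear hζ (hasVelocity_filterCombination hΩ hϑ)) ?_
  simpa only [sub_add_cancel_left, neg_zero] using (tendsto_filterCombination hΩb hν).neg

theorem IsMinimumPhase.tendsto_inner {c : Fin n → ℝ} (hmp : IsMinimumPhase F b c)
    (hF : IsHurwitz F) (hΩ : ∀ i, IsFilterState F b (fun t => f t i) (Ω i))
    (hΩb : ∀ i, BoundedSignal (Ω i)) (hϑ : HasVelocity ϑ ν) (hϑb : BoundedSignal ϑ)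
    (hfb : BoundedSignal f) (hf : UniformContinuousOn f (Set.Ici 0)) (hνb : BoundedSignal ν)
    (hν : Tendsto ν atTop (𝓝 0))
    (hout : Tendsto (fun t => c ⬝ᵥ filterCombination Ω ϑ t) atTop (𝓝 0)) :
    Tendsto (fun t => inner ℝ (f t) (ϑ t)) atTop (𝓝 0) := by
  have hinner : Continuous fun p : EuclideanSpace ℝ (Fin m) × EuclideanSpace ℝ (Fin m) =>
      inner ℝ p.1 p.2 := continuous_inner
  have hinput := (hfb.prodMk hϑb).continuous_comp hinner
  have hinput_unif := (hfb.prodMk hϑb).uniformContinuousOn_comp hinner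
    (uniformContinuousOn_prodMk hf (hϑ.uniformContinuousOn hνb))
  have hscale : Continuous fun r : ℝ => r • b := by fun_prop
  have hcomb := hasVelocity_filterCombination hΩ hϑ
  have hcomb_unif := hF.uniformContinuousOn hcomb <|
    (hinput.continuous_comp hscale).add (boundedSignal_filterCombination hΩb hνb)
  exact hmp.input_tendsto_zero hF hcomb hcomb_unif hinput_unif
    (tendsto_filterCombination hΩb hν) hout

end Swapping

namespace Plant

variable {n m : ℕ} {P : Plant n m} {k : Fin n → ℝ} {θ : EuclideanSpace ℝ (Fin m)} {ξ : ℝ → ℝ}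
  {x : ℝ → Fin n → ℝ}

/-! ### The master system and the response to the noise -/

theorem errorMatrix_mulVec (P : Plant n m) (k z : Fin n → ℝ) :
    P.errorMatrix k *ᵥ z = P.A *ᵥ z - (P.c ⬝ᵥ z) • k := by
  rw [errorMatrix, Matrix.sub_mulVec, Matrix.vecMulVec_mulVec]
  ext i
  simp

theorem continuous_dotProduct (P : Plant n m) : Continuous fun z => P.c ⬝ᵥ z :=
  continuous_const.dotProduct continuous_id

theorem boundedSignal_output {z : ℝ → Fin n → ℝ} (hz : BoundedSignal z) :
    BoundedSignal (P.output z) :=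
  (hz.continuous_comp P.continuous_dotProduct :)

theorem isAdmissible_output {z : ℝ → Fin n → ℝ} (hz : IsAdmissible z) :
    IsAdmissible (P.output z) :=
  (hz.continuous_comp P.continuous_dotProduct :)

theorem tendsto_output {z : ℝ → Fin n → ℝ} (hz : Tendsto z atTop (𝓝 0)) :
    Tendsto (P.output z) atTop (𝓝 0) :=
  (P.continuous_dotProduct.tendsto' 0 0 (dotProduct_zero _)).comp hz

theorem abs_output_le (P : Plant n m) (z : ℝ → Fin n → ℝ) (t : ℝ) :
    |P.output z t| ≤ (∑ i, |P.c i|) * ‖z t‖ := by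
  rw [output, dotProduct, Finset.sum_mul]
  refine (Finset.abs_sum_le_sum_abs _ _).trans (Finset.sum_le_sum fun i _ => ?_)
  rw [abs_mul]
  exact mul_le_mul_of_nonneg_left (norm_le_pi_norm (z t) i) (abs_nonneg _)

theorem output_sub (z w : ℝ → Fin n → ℝ) (t : ℝ) :
    P.output (fun s => z s - w s) t = P.output z t - P.output w t :=
  dotProduct_sub ..

theorem IsTrajectory.hasVelocity (hx : P.IsTrajectory θ x) (k : Fin n → ℝ) :
    HasVelocity x fun t => P.errorMatrix k *ᵥ x t
      + (P.φ₀ (P.output x t) + P.output x t • k + inner ℝ (P.φ (P.output x t)) θ • P.b) :=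
  HasVelocity.congr_velocity hx fun t _ => by
    simp only [errorMatrix_mulVec, output]
    abel

theorem IsTrajectory.uniformContinuousOn_output (hx : P.IsTrajectory θ x) (hxb : BoundedSignal x)
    (hφ₀y : BoundedSignal fun t => P.φ₀ (P.output x t))
    (hφy : BoundedSignal fun t => P.φ (P.output x t)) :
    UniformContinuousOn (P.output x) (Set.Ici 0) := by
  have hA : Continuous fun z => P.A *ᵥ z := by fun_prop
  have hb : Continuous fun v : EuclideanSpace ℝ (Fin m) => inner ℝ v θ • P.b := by fun_prop
  have hvelocity := ((hxb.continuous_comp hA).add hφ₀y).add (hφy.continuous_comp hb)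
  exact (hxb.uniformContinuousOn_comp P.continuous_dotProduct (hx.uniformContinuousOn hvelocity) :)

/-- The input of the system `Ξ̇ₑ = F Ξₑ + w` that gathers the effect of the noise on the
observer. -/
noncomputable def noiseForcing (P : Plant n m) (k : Fin n → ℝ) (θ : EuclideanSpace ℝ (Fin m))
    (ξ : ℝ → ℝ) (x : ℝ → Fin n → ℝ) (t : ℝ) : Fin n → ℝ :=
  P.φ₀ (P.output x t) - P.φ₀ (P.received ξ x t)
    + inner ℝ (P.φ (P.output x t) - P.φ (P.received ξ x t)) θ • P.b - ξ t • k

theorem isNoiseResponse_iff {Ξ : ℝ → Fin n → ℝ} :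
    P.IsNoiseResponse k θ ξ x Ξ ↔
      HasVelocity Ξ fun t => P.errorMatrix k *ᵥ Ξ t + P.noiseForcing k θ ξ x t := by
  simp only [IsNoiseResponse, noiseForcing, add_assoc, add_sub_assoc]

theorem isAdmissible_noiseForcing (hξ : IsAdmissible ξ)
    (hφ₀y : IsAdmissible fun t => P.φ₀ (P.output x t))
    (hφ₀r : IsAdmissible fun t => P.φ₀ (P.received ξ x t))
    (hφy : IsAdmissible fun t => P.φ (P.output x t))
    (hφr : IsAdmissible fun t => P.φ (P.received ξ x t)) :
    IsAdmissible (P.noiseForcing k θ ξ x) := by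
  have hinput : Continuous fun v : EuclideanSpace ℝ (Fin m) => inner ℝ v θ • P.b := by fun_prop
  have hgain : Continuous fun r : ℝ => r • k := by fun_prop
  exact ((hφ₀y.sub hφ₀r).add ((hφy.sub hφr).continuous_comp hinput)).sub
    (hξ.continuous_comp hgain)

theorem received_of_noiseless (hξ0 : ∀ t, 0 ≤ t → ξ t = 0) (x : ℝ → Fin n → ℝ) {t : ℝ}
    (ht : 0 ≤ t) : P.received ξ x t = P.output x t := by
  rw [received, hξ0 t ht, add_zero]

theorem isNoiseResponse_zero (hξ0 : ∀ t, 0 ≤ t → ξ t = 0) : P.IsNoiseResponse k θ ξ x 0 :=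
  (HasVelocity.const 0).congr_velocity fun t ht => by
    simp [received_of_noiseless hξ0 x ht, hξ0 t ht]

/-! ### The closed loop as a cascade -/

section Regressor

variable {Ω : Fin m → ℝ → Fin n → ℝ}

theorem output_filterCombination (ϑ : ℝ → EuclideanSpace ℝ (Fin m)) (t : ℝ) :
    P.output (filterCombination Ω ϑ) t = inner ℝ (P.filteredRegressor Ω t) (ϑ t) := by
  simp only [output, filterCombination, filteredRegressor, dotProduct_sum, dotProduct_smul,
    PiLp.inner_apply, RCLike.inner_apply, conj_trivial, smul_eq_mul]

theorem continuous_toLp_dotProduct (P : Plant n m) :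
    Continuous fun W : Fin m → Fin n → ℝ => WithLp.toLp 2 fun i => P.c ⬝ᵥ W i :=
  (PiLp.continuous_toLp 2 _).comp <|
    continuous_pi fun i => P.continuous_dotProduct.comp (continuous_apply i)

theorem isAdmissible_filteredRegressor {v : Fin m → ℝ → Fin n → ℝ}
    (hΩ : ∀ i, HasVelocity (Ω i) (v i)) (hΩb : ∀ i, BoundedSignal (Ω i)) :
    IsAdmissible (P.filteredRegressor Ω) := by
  have hcont : ContinuousOn (fun t i => Ω i t) (Set.Ici 0) :=
    continuousOn_pi.2 fun i => (hΩ i).continuousOn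
  exact ⟨(P.continuous_toLp_dotProduct.comp_continuousOn hcont).aestronglyMeasurable
    measurableSet_Ici, ((BoundedSignal.pi hΩb).continuous_comp P.continuous_toLp_dotProduct :)⟩

theorem uniformContinuousOn_filteredRegressor (hΩb : ∀ i, BoundedSignal (Ω i))
    (hΩ : ∀ i, UniformContinuousOn (Ω i) (Set.Ici 0)) :
    UniformContinuousOn (P.filteredRegressor Ω) (Set.Ici 0) :=
  ((BoundedSignal.pi hΩb).uniformContinuousOn_comp P.continuous_toLp_dotProduct
    (uniformContinuousOn_pi hΩ) :)

/-- The disturbance `y_r - cᵀ ψ - ω̄ᵀ θ` under which the adaptation is a perturbed gradient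
estimation of `θ`. Here `ψ` stands for `x̂ - ζ`, which does not depend on the estimate. -/
noncomputable def regressionError (P : Plant n m) (ξ : ℝ → ℝ) (x : ℝ → Fin n → ℝ)
    (θ : EuclideanSpace ℝ (Fin m)) (ψ : ℝ → Fin n → ℝ) (Ω : Fin m → ℝ → Fin n → ℝ) (t : ℝ) : ℝ :=
  P.received ξ x t - P.output ψ t - inner ℝ (P.filteredRegressor Ω t) θ

theorem augmentedError_eq (ξ : ℝ → ℝ) (x xh : ℝ → Fin n → ℝ) (θ : EuclideanSpace ℝ (Fin m))
    (θh : ℝ → EuclideanSpace ℝ (Fin m)) (ζ : ℝ → Fin n → ℝ) (Ω : Fin m → ℝ → Fin n → ℝ) (t : ℝ) :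
    P.augmentedError ξ x xh θh ζ Ω t = inner ℝ (P.filteredRegressor Ω t) (θ - θh t)
      + P.regressionError ξ x θ (fun s => xh s - ζ s) Ω t := by
  rw [augmentedError, regressionError, output_sub, inner_sub_right]
  ring

theorem isAdmissible_regressionError (θ : EuclideanSpace ℝ (Fin m)) {ψ : ℝ → Fin n → ℝ}
    (hr : IsAdmissible (P.received ξ x)) (hψ : IsAdmissible ψ)
    (hω : IsAdmissible (P.filteredRegressor Ω)) :
    IsAdmissible (P.regressionError ξ x θ ψ Ω) := by
  have hinner : Continuous fun v : EuclideanSpace ℝ (Fin m) => inner ℝ v θ := by fun_prop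
  exact (hr.sub (isAdmissible_output hψ)).sub (hω.continuous_comp hinner :)

end Regressor

end Plant

namespace Plant

variable {n m : ℕ} {P : Plant n m} {k : Fin n → ℝ} {γ θs : ℝ} {θ : EuclideanSpace ℝ (Fin m)}
  {ξ : ℝ → ℝ} {x xh ζ Ξ : ℝ → Fin n → ℝ} {θh : ℝ → EuclideanSpace ℝ (Fin m)}
  {Ω : Fin m → ℝ → Fin n → ℝ}

theorem isAdmissible_cascadeForcing (hr : IsAdmissible (P.received ξ x))
    (hφ₀r : IsAdmissible fun t => P.φ₀ (P.received ξ x t)) (k : Fin n → ℝ) :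
    IsAdmissible fun t => P.φ₀ (P.received ξ x t) + P.received ξ x t • k := by
  have hgain : Continuous fun r : ℝ => r • k := by fun_prop
  exact hφ₀r.add (hr.continuous_comp hgain :)

theorem isAdmissible_regressorInput (hφr : IsAdmissible fun t => P.φ (P.received ξ x t))
    (i : Fin m) : IsAdmissible fun t => P.φ (P.received ξ x t) i • P.b := by
  have hinput : Continuous fun v : EuclideanSpace ℝ (Fin m) => v i • P.b := by fun_prop
  exact (hφr.continuous_comp hinput :)

theorem isAdmissible_filterInput (hφr : IsAdmissible fun t => P.φ (P.received ξ x t))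
    (hθh : IsAdmissible θh) :
    IsAdmissible fun t => inner ℝ (P.φ (P.received ξ x t)) (θh t) • P.b := by
  have hinput : Continuous fun p : EuclideanSpace ℝ (Fin m) × EuclideanSpace ℝ (Fin m) =>
      inner ℝ p.1 p.2 • P.b := by fun_prop
  exact ((hφr.prodMk hθh).continuous_comp hinput :)

/- The regressor filters and `ψ = x̂ - ζ` are linear systems driven by the received signal alone, so
that the adaptation law is solved next, and the filter of `φ̄ᵀ θ̂` last. -/
theorem exists_isClosedLoop (hF : IsHurwitz (P.errorMatrix k)) (γ : ℝ) (hθs : 0 < θs)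
    (hγ : 0 ≤ γ) (hr : IsAdmissible (P.received ξ x))
    (hφ₀r : IsAdmissible fun t => P.φ₀ (P.received ξ x t))
    (hφr : IsAdmissible fun t => P.φ (P.received ξ x t)) (xh₀ : Fin n → ℝ)
    (θh₀ : EuclideanSpace ℝ (Fin m)) (ζ₀ : Fin n → ℝ) (Ω₀ : Fin m → Fin n → ℝ) :
    ∃ (xh : ℝ → Fin n → ℝ) (θh : ℝ → EuclideanSpace ℝ (Fin m)) (ζ : ℝ → Fin n → ℝ)
      (Ω : Fin m → ℝ → Fin n → ℝ), P.IsClosedLoop k γ θs ξ x xh θh ζ Ω ∧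
        xh 0 = xh₀ ∧ θh 0 = θh₀ ∧ ζ 0 = ζ₀ ∧ ∀ i, Ω i 0 = Ω₀ i := by
  have hw := isAdmissible_cascadeForcing hr hφ₀r k
  obtain ⟨ψ, hψ, hψ0⟩ := hw.exists_linear_response (P.errorMatrix k) (xh₀ - ζ₀)
  choose Ω hΩ hΩ0 using fun i =>
    (isAdmissible_regressorInput hφr i).exists_linear_response (P.errorMatrix k) (Ω₀ i)
  have hψa := IsAdmissible.of_hasVelocity hψ (hF.boundedSignal hψ hw.2)
  have hω : IsAdmissible (P.filteredRegressor Ω) := isAdmissible_filteredRegressor hΩ fun i =>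
    hF.boundedSignal (hΩ i) (isAdmissible_regressorInput hφr i).2
  have hδ := isAdmissible_regressionError 0 hr hψa hω
  obtain ⟨θh, hθh, hθh0⟩ := exists_isGradientEstimate γ hθs 0 hω hδ θh₀
  have hθha := IsAdmissible.of_hasVelocity hθh (hθh.boundedSignal hγ hθs hδ.2)
  obtain ⟨ζ, hζ, hζ0⟩ :=
    (isAdmissible_filterInput hφr hθha).exists_linear_response (P.errorMatrix k) ζ₀
  refine ⟨fun t => ψ t + ζ t, θh, ζ, Ω, ⟨?_, hζ, hΩ, ?_⟩, ?_, hθh0, hζ0, hΩ0⟩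
  · refine (hψ.add hζ).congr_velocity fun t _ => ?_
    simp only [errorMatrix_mulVec, output, Matrix.mulVec_add, dotProduct_add]
    module
  · refine HasVelocity.congr_velocity hθh fun t _ => ?_
    simp only [gradientLaw, augmentedError_eq ξ x _ 0, add_sub_cancel_right]
  · simp only [hψ0, hζ0, sub_add_cancel]

namespace IsClosedLoop

theorem hasVelocity_sub_filter (h : P.IsClosedLoop k γ θs ξ x xh θh ζ Ω) :
    HasVelocity (fun t => xh t - ζ t) fun t => P.errorMatrix k *ᵥ (xh t - ζ t)
      + (P.φ₀ (P.received ξ x t) + P.received ξ x t • k) := by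
  refine (h.observer.sub h.filter).congr_velocity fun t _ => ?_
  simp only [errorMatrix_mulVec, output, Matrix.mulVec_sub]
  module

theorem isGradientEstimate (h : P.IsClosedLoop k γ θs ξ x xh θh ζ Ω)
    (θ : EuclideanSpace ℝ (Fin m)) :
    IsGradientEstimate γ θs θ (P.filteredRegressor Ω)
      (P.regressionError ξ x θ (fun t => xh t - ζ t) Ω) θh := by
  simpa only [IsGradientEstimate, gradientLaw, augmentedError_eq ξ x xh θ] using h.adaptation

/-! ### Boundedness -/

theorem boundedSignal_regressor (hF : IsHurwitz (P.errorMatrix k))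
    (h : P.IsClosedLoop k γ θs ξ x xh θh ζ Ω)
    (hφr : IsAdmissible fun t => P.φ (P.received ξ x t)) (i : Fin m) : BoundedSignal (Ω i) :=
  hF.boundedSignal (h.regressor i) (isAdmissible_regressorInput hφr i).2

theorem isAdmissible_filteredRegressor (hF : IsHurwitz (P.errorMatrix k))
    (h : P.IsClosedLoop k γ θs ξ x xh θh ζ Ω)
    (hφr : IsAdmissible fun t => P.φ (P.received ξ x t)) :
    IsAdmissible (P.filteredRegressor Ω) :=
  Plant.isAdmissible_filteredRegressor h.regressor fun i => h.boundedSignal_regressor hF hφr i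

theorem uniformContinuousOn_filteredRegressor (hF : IsHurwitz (P.errorMatrix k))
    (h : P.IsClosedLoop k γ θs ξ x xh θh ζ Ω)
    (hφr : IsAdmissible fun t => P.φ (P.received ξ x t)) :
    UniformContinuousOn (P.filteredRegressor Ω) (Set.Ici 0) :=
  Plant.uniformContinuousOn_filteredRegressor (fun i => h.boundedSignal_regressor hF hφr i)
    fun i => hF.uniformContinuousOn (h.regressor i) (isAdmissible_regressorInput hφr i).2

theorem isAdmissible_sub_filter (hF : IsHurwitz (P.errorMatrix k))
    (h : P.IsClosedLoop k γ θs ξ x xh θh ζ Ω) (hr : IsAdmissible (P.received ξ x))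
    (hφ₀r : IsAdmissible fun t => P.φ₀ (P.received ξ x t)) :
    IsAdmissible fun t => xh t - ζ t :=
  .of_hasVelocity h.hasVelocity_sub_filter <|
    hF.boundedSignal h.hasVelocity_sub_filter (isAdmissible_cascadeForcing hr hφ₀r k).2

theorem isAdmissible_estimate (hF : IsHurwitz (P.errorMatrix k)) (hγ : 0 ≤ γ) (hθs : 0 < θs)
    (h : P.IsClosedLoop k γ θs ξ x xh θh ζ Ω) (hr : IsAdmissible (P.received ξ x))
    (hφ₀r : IsAdmissible fun t => P.φ₀ (P.received ξ x t))
    (hφr : IsAdmissible fun t => P.φ (P.received ξ x t)) : IsAdmissible θh :=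
  have hδ := isAdmissible_regressionError 0 hr (h.isAdmissible_sub_filter hF hr hφ₀r)
    (h.isAdmissible_filteredRegressor hF hφr)
  .of_hasVelocity h.adaptation ((h.isGradientEstimate 0).boundedSignal hγ hθs hδ.2)

theorem boundedSignal_filter (hF : IsHurwitz (P.errorMatrix k))
    (h : P.IsClosedLoop k γ θs ξ x xh θh ζ Ω)
    (hφr : IsAdmissible fun t => P.φ (P.received ξ x t)) (hθh : IsAdmissible θh) :
    BoundedSignal ζ :=
  hF.boundedSignal h.filter (isAdmissible_filterInput hφr hθh).2

theorem boundedSignal_observer (hF : IsHurwitz (P.errorMatrix k))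
    (h : P.IsClosedLoop k γ θs ξ x xh θh ζ Ω) (hr : IsAdmissible (P.received ξ x))
    (hφ₀r : IsAdmissible fun t => P.φ₀ (P.received ξ x t)) (hζ : BoundedSignal ζ) :
    BoundedSignal xh := by
  simpa only [sub_add_cancel] using (h.isAdmissible_sub_filter hF hr hφ₀r).2.add hζ

end IsClosedLoop

theorem boundedSignal_augmentedError (hr : BoundedSignal (P.received ξ x))
    (hxh : BoundedSignal xh) (hζ : BoundedSignal ζ) (hω : BoundedSignal (P.filteredRegressor Ω))
    (hθh : BoundedSignal θh) : BoundedSignal (P.augmentedError ξ x xh θh ζ Ω) := by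
  have hinner : Continuous fun p : EuclideanSpace ℝ (Fin m) × EuclideanSpace ℝ (Fin m) =>
      inner ℝ p.1 p.2 := continuous_inner
  exact ((hr.sub (boundedSignal_output hxh)).add (boundedSignal_output hζ)).sub
    ((hω.prodMk hθh).continuous_comp hinner :)

/-! ### The error coordinates -/

/-- The part of the error `x - (x̂ - ζ)` that neither the noise response `Ξ` nor the filtered
regressors account for; it solves the unforced equation `ε̇ = F ε`. -/
noncomputable def residualState (θ : EuclideanSpace ℝ (Fin m)) (x ψ Ξ : ℝ → Fin n → ℝ)
    (Ω : Fin m → ℝ → Fin n → ℝ) (t : ℝ) : Fin n → ℝ :=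
  x t - ψ t - Ξ t - filterCombination Ω (fun _ => θ) t

theorem output_residualState (ψ : ℝ → Fin n → ℝ) (t : ℝ) :
    P.output (residualState θ x ψ Ξ Ω) t = P.output x t - P.output ψ t - P.output Ξ t
      - inner ℝ (P.filteredRegressor Ω t) θ := by
  rw [← output_filterCombination fun _ => θ]
  simp only [output, residualState, dotProduct_sub]

theorem regressionError_eq (ψ : ℝ → Fin n → ℝ) (t : ℝ) :
    P.regressionError ξ x θ ψ Ω t
      = (ξ t + P.output Ξ t) + P.output (residualState θ x ψ Ξ Ω) t := by
  rw [regressionError, received, output_residualState]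
  ring

namespace IsClosedLoop

theorem hasVelocity_residualState (h : P.IsClosedLoop k γ θs ξ x xh θh ζ Ω)
    (hx : P.IsTrajectory θ x) (hΞ : P.IsNoiseResponse k θ ξ x Ξ) :
    HasVelocity (residualState θ x (fun t => xh t - ζ t) Ξ Ω) fun t =>
      P.errorMatrix k *ᵥ residualState θ x (fun t => xh t - ζ t) Ξ Ω t := by
  have hlin := (((hx.hasVelocity k).sub_linear h.hasVelocity_sub_filter).sub_linear
    (isNoiseResponse_iff.1 hΞ)).sub_linear
      (hasVelocity_filterCombination h.regressor (.const θ))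
  refine hlin.congr_velocity fun t _ => ?_
  simp only [residualState, received, noiseForcing, filterCombination, inner_sub_left,
    PiLp.zero_apply, zero_smul, Finset.sum_const_zero]
  module

theorem tendsto_infDist_residualSet (hF : IsHurwitz (P.errorMatrix k)) (hγ : 0 ≤ γ)
    (hθs : 0 < θs) (h : P.IsClosedLoop k γ θs ξ x xh θh ζ Ω) (hx : P.IsTrajectory θ x)
    (hξ : BoundedSignal ξ) (hΞ : P.IsNoiseResponse k θ ξ x Ξ) (hΞb : BoundedSignal (P.output Ξ)) :
    Tendsto (fun t => Metric.infDist (θ - θh t)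
      (residualSet γ θs θ fun s => ξ s + P.output Ξ s)) atTop (𝓝 0) := by
  have hest := h.isGradientEstimate θ
  rw [funext (regressionError_eq (Ξ := Ξ) _)] at hest
  have hε := h.hasVelocity_residualState hx hΞ
  refine hest.tendsto_infDist_residualSet hγ hθs (hξ.add hΞb) (tendsto_output ?_)
  exact hF.tendsto_zero (w := 0) (by simpa using hε) tendsto_const_nhds

/-! ### Noiseless transmission -/

theorem exists_exp_decay_regressionError (hF : IsHurwitz (P.errorMatrix k))
    (h : P.IsClosedLoop k γ θs ξ x xh θh ζ Ω) (hx : P.IsTrajectory θ x)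
    (hξ0 : ∀ t, 0 ≤ t → ξ t = 0) :
    ∃ a C : ℝ, 0 < a ∧ ∀ t, 0 ≤ t →
      |P.regressionError ξ x θ (fun s => xh s - ζ s) Ω t| ≤ C * Real.exp (-a * t) := by
  obtain ⟨a, C, ha, hC⟩ :=
    hF.exists_exp_decay (h.hasVelocity_residualState hx (isNoiseResponse_zero hξ0))
  refine ⟨a, (∑ i, |P.c i|) * C, ha, fun t ht => ?_⟩
  rw [regressionError_eq (Ξ := 0), hξ0 t ht, output, Pi.zero_apply, dotProduct_zero, add_zero,
    zero_add, mul_assoc]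
  exact (P.abs_output_le _ t).trans (by gcongr; exact hC t ht)

theorem tendsto_regressionError (hF : IsHurwitz (P.errorMatrix k))
    (h : P.IsClosedLoop k γ θs ξ x xh θh ζ Ω) (hx : P.IsTrajectory θ x)
    (hξ0 : ∀ t, 0 ≤ t → ξ t = 0) :
    Tendsto (P.regressionError ξ x θ (fun s => xh s - ζ s) Ω) atTop (𝓝 0) := by
  obtain ⟨a, C, ha, hC⟩ := h.exists_exp_decay_regressionError hF hx hξ0
  have hexp : Tendsto (fun t => C * Real.exp (-a * t)) atTop (𝓝 0) := by
    simpa only [mul_zero, Function.comp_def, id] using (Real.tendsto_exp_atBot.comp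
      (tendsto_id.const_mul_atTop_of_neg (neg_lt_zero.2 ha))).const_mul C
  exact squeeze_zero_norm' ((eventually_ge_atTop 0).mono hC) hexp

theorem tendsto_dissipation (hF : IsHurwitz (P.errorMatrix k)) (hγ : 0 ≤ γ) (hθs : 0 < θs)
    (hθ : ‖θ‖ ≤ θs) (h : P.IsClosedLoop k γ θs ξ x xh θh ζ Ω) (hx : P.IsTrajectory θ x)
    (hξ0 : ∀ t, 0 ≤ t → ξ t = 0) (hφr : IsAdmissible fun t => P.φ (P.received ξ x t)) :
    Tendsto (fun t => dissipation γ θs θ (P.filteredRegressor Ω t) (θh t)) atTop (𝓝 0) := by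
  obtain ⟨a, C, ha, hC⟩ := h.exists_exp_decay_regressionError hF hx hξ0
  exact (h.isGradientEstimate θ).tendsto_dissipation hγ hθs hθ
    (h.isAdmissible_filteredRegressor hF hφr).2
    (h.uniformContinuousOn_filteredRegressor hF hφr) ha hC

theorem exists_velocity_tendsto_zero (hF : IsHurwitz (P.errorMatrix k)) (hγ : 0 < γ)
    (hθs : 0 < θs) (hθ : ‖θ‖ < θs) (h : P.IsClosedLoop k γ θs ξ x xh θh ζ Ω)
    (hx : P.IsTrajectory θ x) (hξ0 : ∀ t, 0 ≤ t → ξ t = 0) (hr : IsAdmissible (P.received ξ x))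
    (hφ₀r : IsAdmissible fun t => P.φ₀ (P.received ξ x t))
    (hφr : IsAdmissible fun t => P.φ (P.received ξ x t)) :
    ∃ ν, HasVelocity θh ν ∧ BoundedSignal ν ∧ Tendsto ν atTop (𝓝 0) := by
  have hω := h.isAdmissible_filteredRegressor hF hφr
  have hδ := isAdmissible_regressionError θ hr (h.isAdmissible_sub_filter hF hr hφ₀r) hω
  exact ⟨_, h.isGradientEstimate θ, boundedSignal_gradientLaw hθs hω.2 hδ.2
      (h.isAdmissible_estimate hF hγ.le hθs hr hφ₀r hφr).2,
    tendsto_gradientLaw_of_tendsto_dissipation hγ hθ hω.2 (h.tendsto_regressionError hF hx hξ0)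
      (h.tendsto_dissipation hF hγ.le hθs hθ.le hx hξ0 hφr)⟩

/- Along a noiseless trajectory `y - ŷ = ē - (H(p)[φ̄ᵀ θ̂] - ω̄ᵀ θ̂)`, and the swapping term
vanishes because the estimate becomes slow. -/
theorem tendsto_outputError (hF : IsHurwitz (P.errorMatrix k))
    (h : P.IsClosedLoop k γ θs ξ x xh θh ζ Ω) (hx : P.IsTrajectory θ x)
    (hξ0 : ∀ t, 0 ≤ t → ξ t = 0) (hΩ : ∀ i, BoundedSignal (Ω i))
    {ν : ℝ → EuclideanSpace ℝ (Fin m)} (hθh : HasVelocity θh ν) (hν : Tendsto ν atTop (𝓝 0))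
    (hωϑ : Tendsto (fun t => inner ℝ (P.filteredRegressor Ω t) (θ - θh t)) atTop (𝓝 0)) :
    Tendsto (fun t => P.output x t - P.output xh t) atTop (𝓝 0) := by
  have herror := hωϑ.add (h.tendsto_regressionError hF hx hξ0)
  have hswap := tendsto_output (P := P) <|
    hF.tendsto_sub_filterCombination h.filter h.regressor hΩ hθh hν
  have hlim := herror.sub hswap
  rw [add_zero, sub_zero] at hlim
  refine hlim.congr' ((eventually_ge_atTop 0).mono fun t ht => ?_)
  rw [← augmentedError_eq, output_sub, output_filterCombination, augmentedError,
    received_of_noiseless hξ0 x ht]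
  ring

theorem tendsto_parameterError (hF : IsHurwitz (P.errorMatrix k))
    (hH : IsMinimumPhase (P.errorMatrix k) P.b P.c) (h : P.IsClosedLoop k γ θs ξ x xh θh ζ Ω)
    (hξ0 : ∀ t, 0 ≤ t → ξ t = 0) (hφ : Continuous P.φ) (hy : BoundedSignal (P.output x))
    (hy' : UniformContinuousOn (P.output x) (Set.Ici 0))
    (hexc : PersistentlyExciting fun t => P.φ (P.output x t)) (hΩ : ∀ i, BoundedSignal (Ω i))
    {ν : ℝ → EuclideanSpace ℝ (Fin m)} (hθh : HasVelocity θh ν) (hθhb : BoundedSignal θh)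
    (hνb : BoundedSignal ν) (hν : Tendsto ν atTop (𝓝 0))
    (hωϑ : Tendsto (fun t => inner ℝ (P.filteredRegressor Ω t) (θ - θh t)) atTop (𝓝 0)) :
    Tendsto (fun t => θ - θh t) atTop (𝓝 0) := by
  have hϑ : HasVelocity (fun t => θ - θh t) fun t => -ν t := by
    simpa only [zero_sub] using (HasVelocity.const θ).sub hθh
  have hϑb : BoundedSignal fun t => θ - θh t := (BoundedSignal.const θ).sub hθhb
  have hνb' : BoundedSignal fun t => -ν t := by
    simpa only [zero_sub] using (BoundedSignal.const 0).sub hνb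
  have hν' : Tendsto (fun t => -ν t) atTop (𝓝 0) := by simpa only [neg_zero] using hν.neg
  have hΩy (i : Fin m) :
      IsFilterState (P.errorMatrix k) P.b (fun t => P.φ (P.output x t) i) (Ω i) :=
    HasVelocity.congr_velocity (h.regressor i) fun t ht => by
      simp only [received_of_noiseless hξ0 x ht]
  have hfϑ := hH.tendsto_inner hF hΩy hΩ hϑ hϑb hexc.2.1 (hy.uniformContinuousOn_comp hφ hy')
    hνb' hν' (hωϑ.congr fun t => (output_filterCombination _ t).symm)
  exact hexc.tendsto_zero hϑ hν' hfϑ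

end IsClosedLoop

end Plant

end AdaptiveSync

theorem theorem4_general {n m : ℕ} (P : Plant n m)
    (hφ₀_meas : Measurable P.φ₀) (hφ_meas : Measurable P.φ)
    (hφ₀ : LocallyBounded P.φ₀) (hφ : LocallyBounded P.φ)
    (k : Fin n → ℝ) (hF : IsHurwitz (P.errorMatrix k))
    (θ : EuclideanSpace ℝ (Fin m))
    (ξ : ℝ → ℝ) (hξ_meas : AEMeasurable ξ (volume.restrict (Set.Ici (0 : ℝ))))
    (hξ : BoundedSignal ξ)
    (γ θs : ℝ) (hγ : 0 < γ) (hθs : 0 < θs)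
    (x : ℝ → Fin n → ℝ) (hx : P.IsTrajectory θ x)
    (hxb : BoundedSignal x) :
    (∀ (xh₀ : Fin n → ℝ) (θh₀ : EuclideanSpace ℝ (Fin m)) (ζ₀ : Fin n → ℝ)
        (Ω₀ : Fin m → Fin n → ℝ),
      ∃ (xh : ℝ → Fin n → ℝ) (θh : ℝ → EuclideanSpace ℝ (Fin m)) (ζ : ℝ → Fin n → ℝ)
        (Ω : Fin m → ℝ → Fin n → ℝ),
        P.IsClosedLoop k γ θs ξ x xh θh ζ Ω ∧
          xh 0 = xh₀ ∧ θh 0 = θh₀ ∧ ζ 0 = ζ₀ ∧ ∀ i, Ω i 0 = Ω₀ i) ∧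
    (∀ Ξ₀ : Fin n → ℝ, ∃ Ξ : ℝ → Fin n → ℝ, P.IsNoiseResponse k θ ξ x Ξ ∧ Ξ 0 = Ξ₀) ∧
    ∀ (xh : ℝ → Fin n → ℝ) (θh : ℝ → EuclideanSpace ℝ (Fin m)) (ζ : ℝ → Fin n → ℝ)
      (Ω : Fin m → ℝ → Fin n → ℝ),
      P.IsClosedLoop k γ θs ξ x xh θh ζ Ω →
        (BoundedSignal x ∧ BoundedSignal (P.output x) ∧ BoundedSignal (P.received ξ x) ∧
          BoundedSignal xh ∧ BoundedSignal (P.output xh) ∧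
          BoundedSignal θh ∧ BoundedSignal (fun t => θ - θh t) ∧
          BoundedSignal ζ ∧ BoundedSignal (P.output ζ) ∧
          (∀ i, BoundedSignal (Ω i)) ∧ BoundedSignal (P.filteredRegressor Ω) ∧
          BoundedSignal (P.augmentedError ξ x xh θh ζ Ω)) ∧
        (∀ Ξ : ℝ → Fin n → ℝ, P.IsNoiseResponse k θ ξ x Ξ →
          BoundedSignal Ξ ∧ BoundedSignal (P.output Ξ) ∧
          Tendsto (fun t => Metric.infDist (θ - θh t)
              (residualSet γ θs θ fun s => ξ s + P.output Ξ s))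
            atTop (𝓝 0)) ∧
        ((∀ t, 0 ≤ t → ξ t = 0) → ‖θ‖ < θs →
          Tendsto (fun t => P.output x t - P.output xh t) atTop (𝓝 0) ∧
          (Continuous P.φ → PersistentlyExciting (fun t => P.φ (P.output x t)) →
            IsMinimumPhase (P.errorMatrix k) P.b P.c →
            Tendsto (fun t => ‖θ - θh t‖) atTop (𝓝 0))) := by
  have hξa : IsAdmissible ξ := ⟨hξ_meas.aestronglyMeasurable, hξ⟩
  have hy : IsAdmissible (P.output x) := Plant.isAdmissible_output (.of_hasVelocity hx hxb)
  have hr : IsAdmissible (P.received ξ x) := hy.add hξa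
  have hφ₀y := hy.comp_locallyBounded hφ₀_meas hφ₀
  have hφ₀r := hr.comp_locallyBounded hφ₀_meas hφ₀
  have hφy := hy.comp_locallyBounded hφ_meas hφ
  have hφr := hr.comp_locallyBounded hφ_meas hφ
  have hw := Plant.isAdmissible_noiseForcing (k := k) (θ := θ) hξa hφ₀y hφ₀r hφy hφr
  refine ⟨Plant.exists_isClosedLoop hF γ hθs hγ.le hr hφ₀r hφr, fun Ξ₀ => ?_,
    fun xh θh ζ Ω h => ?_⟩
  · simpa only [Plant.isNoiseResponse_iff] using hw.exists_linear_response (P.errorMatrix k) Ξ₀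
  have hΩ := h.boundedSignal_regressor hF hφr
  have hω := h.isAdmissible_filteredRegressor hF hφr
  have hθh := h.isAdmissible_estimate hF hγ.le hθs hr hφ₀r hφr
  have hζ := h.boundedSignal_filter hF hφr hθh
  have hxh := h.boundedSignal_observer hF hr hφ₀r hζ
  refine ⟨⟨hxb, hy.2, hr.2, hxh, Plant.boundedSignal_output hxh, hθh.2,
    (BoundedSignal.const θ).sub hθh.2, hζ, Plant.boundedSignal_output hζ, hΩ, hω.2,
    Plant.boundedSignal_augmentedError hr.2 hxh hζ hω.2 hθh.2⟩, fun Ξ hΞ => ?_, fun hξ0 hθ => ?_⟩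
  · have hΞb := hF.boundedSignal (Plant.isNoiseResponse_iff.1 hΞ) hw.2
    have hΞout := Plant.boundedSignal_output (P := P) hΞb
    exact ⟨hΞb, hΞout, h.tendsto_infDist_residualSet hF hγ.le hθs hx hξ hΞ hΞout⟩
  · obtain ⟨ν, hν, hνb, hν0⟩ := h.exists_velocity_tendsto_zero hF hγ hθs hθ hx hξ0 hr hφ₀r hφr
    have hωϑ := tendsto_inner_of_tendsto_dissipation hγ hθ.le <|
      h.tendsto_dissipation hF hγ.le hθs hθ.le hx hξ0 hφr
    refine ⟨h.tendsto_outputError hF hx hξ0 hΩ hν hν0 hωϑ, fun hφc hexc hmp => ?_⟩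
    have hy' := hx.uniformContinuousOn_output hxb hφ₀y.2 hφy.2
    simpa only [norm_zero] using (h.tendsto_parameterError hF hmp hξ0 hφc hy.2 hy' hexc hΩ hν
      hθh.2 hνb hν0 hωϑ).norm

theorem theorem4 {n m : ℕ} (P : Plant n m)
    (hφ₀_meas : Measurable P.φ₀) (hφ_meas : Measurable P.φ)
    (hφ₀ : LocallyBounded P.φ₀) (hφ : LocallyBounded P.φ)
    (hP : P.BoundedTrajectories)
    (k : Fin n → ℝ) (hF : IsHurwitz (P.errorMatrix k))
    (θ : EuclideanSpace ℝ (Fin m))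
    (ξ : ℝ → ℝ) (hξ_meas : AEMeasurable ξ (volume.restrict (Set.Ici (0 : ℝ))))
    (hξ : BoundedSignal ξ)
    (γ θs : ℝ) (hγ : 0 < γ) (hθs : 0 < θs)
    (x : ℝ → Fin n → ℝ) (hx : P.IsTrajectory θ x) :
    -- the closed loop has a solution on `[0, ∞)` for all initial conditions
    (∀ (xh₀ : Fin n → ℝ) (θh₀ : EuclideanSpace ℝ (Fin m)) (ζ₀ : Fin n → ℝ)
        (Ω₀ : Fin m → Fin n → ℝ),
      ∃ (xh : ℝ → Fin n → ℝ) (θh : ℝ → EuclideanSpace ℝ (Fin m)) (ζ : ℝ → Fin n → ℝ)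
        (Ω : Fin m → ℝ → Fin n → ℝ),
        P.IsClosedLoop k γ θs ξ x xh θh ζ Ω ∧
          xh 0 = xh₀ ∧ θh 0 = θh₀ ∧ ζ 0 = ζ₀ ∧ ∀ i, Ω i 0 = Ω₀ i) ∧
    (∀ Ξ₀ : Fin n → ℝ, ∃ Ξ : ℝ → Fin n → ℝ, P.IsNoiseResponse k θ ξ x Ξ ∧ Ξ 0 = Ξ₀) ∧
    -- and every solution has the following properties
    ∀ (xh : ℝ → Fin n → ℝ) (θh : ℝ → EuclideanSpace ℝ (Fin m)) (ζ : ℝ → Fin n → ℝ)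
      (Ω : Fin m → ℝ → Fin n → ℝ),
      P.IsClosedLoop k γ θs ξ x xh θh ζ Ω →
        -- (i) boundedness of all signals
        (BoundedSignal x ∧ BoundedSignal (P.output x) ∧ BoundedSignal (P.received ξ x) ∧
          BoundedSignal xh ∧ BoundedSignal (P.output xh) ∧
          BoundedSignal θh ∧ BoundedSignal (fun t => θ - θh t) ∧
          BoundedSignal ζ ∧ BoundedSignal (P.output ζ) ∧
          (∀ i, BoundedSignal (Ω i)) ∧ BoundedSignal (P.filteredRegressor Ω) ∧
          BoundedSignal (P.augmentedError ξ x xh θh ζ Ω)) ∧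
        -- (i) convergence of the parameter error to the residual set
        (∀ Ξ : ℝ → Fin n → ℝ, P.IsNoiseResponse k θ ξ x Ξ →
          BoundedSignal Ξ ∧ BoundedSignal (P.output Ξ) ∧
          Tendsto (fun t => Metric.infDist (θ - θh t)
              (residualSet γ θs θ fun s => ξ s + P.output Ξ s))
            atTop (𝓝 0)) ∧
        ((∀ t, 0 ≤ t → ξ t = 0) → ‖θ‖ < θs →
          -- (ii) regulation of the output error
          Tendsto (fun t => P.output x t - P.output xh t) atTop (𝓝 0) ∧
          -- (iii) parameter convergence
          (Continuous P.φ → PersistentlyExciting (fun t => P.φ (P.output x t)) →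
            IsMinimumPhase (P.errorMatrix k) P.b P.c →
            Tendsto (fun t => ‖θ - θh t‖) atTop (𝓝 0))) :=
  theorem4_general P hφ₀_meas hφ_meas hφ₀ hφ k hF θ ξ hξ_meas hξ γ θs hγ hθs x hx (hP θ x hx)
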